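/- **Decay estimates by energy bounds.** Work in $\mathbb{R}^{1+3}$ with points $(t,x)$, $r=|x|$. Let $\mathcal K=\{t>r+1\}$, $\partial\mathcal K=\{t=r+1\}$, $s=\sqrt{t^2-r^2}$, and $\mathcal H_s=\{t=\sqrt{s^2+r^2}\}$ for $s>0$. For $a\in\{1,2,3\}$ let $$L_a=x^a\partial_t+t\partial_a,\qquad \underline\partial_s=\frac st\,\partial_t,\qquad \underline\partial_a=\frac{x^a}{t}\partial_t+\partial_a,\qquad K=s\underline\partial_s+2\sum_a x^a\underline\partial_a .$$ For words $I=(\alpha_1,\dots,\alpha_m)$ in $\{0,1,2,3\}$ (with $\partial_0=\partial_t$) and $J=(a_1,\dots,a_n)$ in $\{1,2,3\}$ put $|I|=m$, $|J|=n$ and $\partial^IL^J=\partial_{\alpha_1}\cdots\partial_{\alpha_m}L_{a_1}\cdots L_{a_n}$. For a function $v$ on $\mathcal K$ define the conformal energy $$E(s,v)=\int_{\mathcal H_s\cap\mathcal K}\Big(\sum_{a=1}^3(s\,\underline\partial_a v)^2+(Kv+2v)^2\Big)dx ,$$ where $\int_{\mathcal H_s\cap\mathcal K}f\,dx$ is the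 integral of $x\mapsto f(\sqrt{s^2+|x|^2},x)$ over the $x\in\mathbb{R}^3$ with $(\sqrt{s^2+|x|^2},x)\in\mathcal K$. For every integer $N\ge 0$ there is a constant $C>0$, depending only on $N$, such that for every function $u$ of class $C^{N+1}$ on $\mathcal K$ that vanishes in $U\cap\mathcal K$ for some open neighbourhood $U$ of $\partial\mathcal K$, and for every $s>0$, the following holds at every point of $\mathcal H_s\cap\mathcal K$, for all $a,b\in\{1,2,3\}$. 1. If $|I|+|J|\le N-2$, then each of $$s\,t^{1/2}|\partial^IL^Ju|,\quad s\,t^{3/2}|\underline\partial_a\partial^IL^Ju|,\quad s^2t^{1/2}|\underline\partial_s\partial^IL^Ju|,\quad s\,t^{3/2}|\partial^IL^J\underline\partial_au|,\quad s^2t^{1/2}|\partial^IL^J\underline\partial_su|$$ is at most $C\sum_{|I'|+|J'|\le N}E(s,\partial^{I'}L^{J'}u)^{1/2}$. 2. If $|I|+|J|\le N-3$, then each of $$s^2t^{3/2}|\underline\partial_s\underline\partial_a\partial^IL^Ju|,\quad s\,t^{5/2}|\underline\partial_a\underline\partial_b\partial^IL^Ju|,\quad s^2t^{3/2}|\partial^IL^J\underline\partial_s\underline\partial_au|,\quad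 s\,t^{5/2}|\partial^IL^J\underline\partial_a\underline\partial_bu|$$ is at most $C\sum_{|I'|+|J'|\le N}E(s,\partial^{I'}L^{J'}u)^{1/2}$. -/

import Mathlib

noncomputable section

namespace HypConformal

/-- Space-time `ℝ^{1+3}`: points `(t, x)` with `t : ℝ` and `x` in Euclidean three-space. -/
abbrev Spacetime : Type := ℝ × EuclideanSpace ℝ (Fin 3)

/-- The interior of the light cone `𝒦 = {(t, x) | t > |x| + 1}`. -/
def cone : Set Spacetime := {p | ‖p.2‖ + 1 < p.1}

/-- The conical boundary `∂𝒦 = {(t, x) | t = |x| + 1}`. -/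
def coneBoundary : Set Spacetime := {p | p.1 = ‖p.2‖ + 1}

/-- The function `u`, considered on `𝒦`, vanishes near the conical boundary. -/
def VanishesNearConeBoundary (u : Spacetime → ℝ) : Prop :=
  ∃ U : Set Spacetime, IsOpen U ∧ coneBoundary ⊆ U ∧ ∀ p ∈ U ∩ cone, u p = 0

/-- The point of the hyperboloid of parameter `s` above `x`: `(√(s² + |x|²), x)`. -/
def hypPoint (s : ℝ) (x : EuclideanSpace ℝ (Fin 3)) : Spacetime :=
  (√(s ^ 2 + ‖x‖ ^ 2), x)

/-- The hyperboloid `ℋ_s = {(t, x) | t = √(s² + |x|²)}`. -/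
def hyperboloid (s : ℝ) : Set Spacetime := {p | p.1 = √(s ^ 2 + ‖p.2‖ ^ 2)}

/-- The hyperbolic time `s = √(t² - |x|²)`. -/
def hypTime (p : Spacetime) : ℝ := √(p.1 ^ 2 - ‖p.2‖ ^ 2)

/-- The vectors of the natural frame: index `0` is the time direction, and index `a.succ`
the `a`-th spatial direction. -/
def frameVec (α : Fin 4) : Spacetime :=
  Fin.cases (motive := fun _ => Spacetime) (1, 0) (fun a => (0, EuclideanSpace.single a 1)) α

/-- The partial derivative `∂_α u`. -/
def pd (α : Fin 4) (u : Spacetime → ℝ) : Spacetime → ℝ :=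
  fun p => fderiv ℝ u p (frameVec α)

/-- The Lorentz boost `L_a u = x^a ∂_t u + t ∂_a u`. -/
def boost (a : Fin 3) (u : Spacetime → ℝ) : Spacetime → ℝ :=
  fun p => p.2 a * pd 0 u p + p.1 * pd a.succ u p

/-- The hyperbolic frame derivative `∂̲_s u = (s/t) ∂_t u`. -/
def hypDs (u : Spacetime → ℝ) : Spacetime → ℝ :=
  fun p => hypTime p / p.1 * pd 0 u p

/-- The hyperbolic frame derivative `∂̲_a u = (x^a/t) ∂_t u + ∂_a u`. -/
def hypD (a : Fin 3) (u : Spacetime → ℝ) : Spacetime → ℝ :=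
  fun p => p.2 a / p.1 * pd 0 u p + pd a.succ u p

/-- The operator `K u = s ∂̲_s u + 2 x^a ∂̲_a u`. -/
def opK (u : Spacetime → ℝ) : Spacetime → ℝ :=
  fun p => hypTime p * hypDs u p + 2 * ∑ a : Fin 3, p.2 a * hypD a u p

/-- `∂^I L^J u` for words `I = (α₁, …, α_m)` and `J = (a₁, …, a_n)`:
`∂_{α₁} ⋯ ∂_{α_m} L_{a₁} ⋯ L_{a_n} u`. The orders `|I|`, `|J|` are the lengths of the words. -/
def derivWord (I : List (Fin 4)) (J : List (Fin 3)) (u : Spacetime → ℝ) : Spacetime → ℝ :=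
  I.foldr pd (J.foldr boost u)

/-- The conformal energy on `ℋ_s` of a function `u` on `𝒦`:
`∫_{ℋ_s} (∑_a (s ∂̲_a u)² + (K u + 2 u)²) dx`, where the integral over `ℋ_s` is taken
in the coordinate `x` (over the part of `ℋ_s` inside `𝒦`, where `u` is given). -/
def energy (s : ℝ) (u : Spacetime → ℝ) : ℝ :=
  ∫ x in {x : EuclideanSpace ℝ (Fin 3) | hypPoint s x ∈ cone},
    ((∑ a : Fin 3, (s * hypD a u (hypPoint s x)) ^ 2) +
      (opK u (hypPoint s x) + 2 * u (hypPoint s x)) ^ 2)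

/-- The sum of `energy s (∂^I L^J u) ^ (1/2)` over all words with `|I| + |J| ≤ N`. -/
def energySum (N : ℕ) (s : ℝ) (u : Spacetime → ℝ) : ℝ :=
  ∑ i ∈ Finset.range (N + 1), ∑ j ∈ Finset.range (N + 1 - i),
    ∑ I : Fin i → Fin 4, ∑ J : Fin j → Fin 3,
      √(energy s (derivWord (List.ofFn I) (List.ofFn J) u))

end HypConformal

end

open HypConformal

/-!
The estimates are obtained by applying a Klainerman–Sobolev inequality on the hyperboloid `ℋ_s` to
functions `P u`, where `P` runs through classes of operators that are stable under the fields `∂_α`,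
`L_a`, and for which a suitably weighted `L²` norm of `P u` on `ℋ_s` is controlled by the energies.

*Reduction.* Since `u` vanishes near `∂𝒦`, its extension by zero from the cone is of class `C^{N+1}`
on the whole space-time, with support in the cone (`exists_coneSupported_eqOn`). Restricted to `ℋ_s`
and read in the coordinate `x`, such functions have compact support, and `∂̲_a` is the partial
derivative `∂/∂x^a`.

*Operator classes.* Let `Z^W` be a word of order at most `n` in the fields. The classes are spanned,
over an algebra of bounded coefficients generated by `x^a/t`, `1/t` and `t/s²`, by

* `Z^W`, with the weight `s/t`;
* `∂̲_a Z^W` and `t⁻¹ Z^W`, with the weight `s`;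
* `(s/t) ∂_α Z^W` and `s⁻¹ Z^W`, with the weight `s²/t`.

Every field maps each class into the same class with `n + 1` in place of `n`
(`isStableClass_word`, `isStableClass_tangential`, `isStableClass_transversal`); here `t ≤ s²` in the
cone is used. The expressions with one hyperbolic derivative belong to these classes, and those with
two do so after multiplication by `t`.

*`L²` bounds.* The weighted square of an element of a class is bounded pointwise by the sum over
all words of `∑ (s ∂̲_a w)² + (K w + 2 w)² + ((s/t) w)²`, with `w` the derivative of `u` along the
word (`densityBound_word` and its companions); words in arbitrary order are first rewritten in the
form `∂^I L^J` (`comb_wordD_orderedWord`). The integral over `ℋ_s` of the last term is controlled by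
the others through Hardy's inequality (`hardy`, `integral_density_le`).

*Pointwise bounds.* A Sobolev inequality on a ball of radius `t/2` in `ℋ_s`, in which `t ∂̲_a = L_a`,
gives `t³ |F|² ≤ C ∑_{|J| ≤ 2} ‖L^J F‖²` (`exists_klainerman_sobolev`). The Sobolev inequality itself
(`exists_sobolev_ball`) follows by integrating `φ(0) = ∫₀¹ r ((1 - r)² φ)'' dr` over all rays from the
centre of the ball.
-/

noncomputable section

open scoped ContDiff Topology

namespace HypConformal

/-! ### The seven commuting fields -/

/-- Indices of the vector fields in play: `inl α` stands for `∂_α`, `inr a` for `L_a`. -/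
abbrev FieldIndex : Type := Fin 4 ⊕ Fin 3

/-- The vector fields `∂_α` and `L_a = x^a ∂_t + t ∂_a`, as maps from space-time to itself. -/
def field : FieldIndex → Spacetime → Spacetime
  | .inl α, _ => frameVec α
  | .inr a, p => p.2 a • frameVec 0 + p.1 • frameVec a.succ

/-- The derivative of `f` along one of the fields `∂_α`, `L_a`. -/
def fieldD (i : FieldIndex) (f : Spacetime → ℝ) : Spacetime → ℝ :=
  fun p => fderiv ℝ f p (field i p)

/-- Iterated derivatives along an arbitrary word in the fields `∂_α`, `L_a`, in any order. -/
def wordD (W : List FieldIndex) (f : Spacetime → ℝ) : Spacetime → ℝ := W.foldr fieldD f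

lemma fieldD_inl (α : Fin 4) : fieldD (.inl α) = pd α := rfl

lemma fieldD_inr (a : Fin 3) : fieldD (.inr a) = boost a := by
  funext f p
  simp [fieldD, field, boost, pd]

lemma derivWord_eq_wordD (I : List (Fin 4)) (J : List (Fin 3)) (f : Spacetime → ℝ) :
    derivWord I J f = wordD (I.map .inl ++ J.map .inr) f := by
  simp only [derivWord, wordD, List.foldr_append, List.foldr_map, fieldD_inl, fieldD_inr]

lemma frameVec_zero : frameVec 0 = (1, 0) := rfl

lemma frameVec_succ (a : Fin 3) : frameVec a.succ = (0, EuclideanSpace.single a 1) := rfl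

lemma isOpen_cone : IsOpen cone :=
  isOpen_lt (by fun_prop) (by fun_prop)

lemma cone_time_pos {p : Spacetime} (hp : p ∈ cone) : 1 < p.1 := by
  have : ‖p.2‖ + 1 < p.1 := hp
  linarith [norm_nonneg p.2]

lemma abs_coord_le (x : EuclideanSpace ℝ (Fin 3)) (a : Fin 3) : |x a| ≤ ‖x‖ := by
  simpa using PiLp.norm_apply_le x a

/-- In the cone `t ≤ s²`, because `t² - r² = (t - r)(t + r)` and `t - r > 1`. -/
lemma cone_time_le_sq {p : Spacetime} (hp : p ∈ cone) : p.1 ≤ p.1 ^ 2 - ‖p.2‖ ^ 2 := by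
  have h : ‖p.2‖ + 1 < p.1 := hp
  nlinarith [norm_nonneg p.2]

lemma cone_sq_pos {p : Spacetime} (hp : p ∈ cone) : 0 < p.1 ^ 2 - ‖p.2‖ ^ 2 := by
  linarith [cone_time_le_sq hp, cone_time_pos hp]

lemma hypTime_sq {p : Spacetime} (hp : p ∈ cone) : hypTime p ^ 2 = p.1 ^ 2 - ‖p.2‖ ^ 2 :=
  Real.sq_sqrt (cone_sq_pos hp).le

lemma hypTime_pos {p : Spacetime} (hp : p ∈ cone) : 0 < hypTime p :=
  Real.sqrt_pos.2 (cone_sq_pos hp)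

lemma norm_sq_eq_sum (x : EuclideanSpace ℝ (Fin 3)) : ‖x‖ ^ 2 = ∑ a, x a ^ 2 := by
  simp [EuclideanSpace.norm_sq_eq]

lemma fieldD_congr {f g : Spacetime → ℝ} (h : Set.EqOn f g cone) (i : FieldIndex) :
    Set.EqOn (fieldD i f) (fieldD i g) cone := fun p hp => by
  have : f =ᶠ[𝓝 p] g := h.eventuallyEq_of_mem (isOpen_cone.mem_nhds hp)
  simp only [fieldD, this.fderiv_eq]

lemma wordD_congr {f g : Spacetime → ℝ} (h : Set.EqOn f g cone) (W : List FieldIndex) :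
    Set.EqOn (wordD W f) (wordD W g) cone := by
  induction W with
  | nil => exact h
  | cons i W ih => exact fieldD_congr ih i

section rules

variable {f g : Spacetime → ℝ} {p : Spacetime}

lemma fieldD_add (hf : DifferentiableAt ℝ f p) (hg : DifferentiableAt ℝ g p) (i : FieldIndex) :
    fieldD i (fun q => f q + g q) p = fieldD i f p + fieldD i g p := by
  simp [fieldD, fderiv_fun_add hf hg]

lemma fieldD_mul (hf : DifferentiableAt ℝ f p) (hg : DifferentiableAt ℝ g p) (i : FieldIndex) :
    fieldD i (fun q => f q * g q) p = fieldD i f p * g p + f p * fieldD i g p := by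
  simp [fieldD, fderiv_fun_mul hf hg]; ring

lemma fieldD_inv (hf : DifferentiableAt ℝ f p) (h : f p ≠ 0) (i : FieldIndex) :
    fieldD i (fun q => (f q)⁻¹) p = - fieldD i f p / f p ^ 2 := by
  have := (hasDerivAt_inv h).comp_hasFDerivAt p hf.hasFDerivAt
  simp only [fieldD]
  rw [show (fun q => (f q)⁻¹) = Inv.inv ∘ f from rfl, this.fderiv]
  simp; ring

lemma fieldD_const (r : ℝ) (i : FieldIndex) : fieldD i (fun _ => r) p = 0 := by
  simp [fieldD]

lemma differentiable_time : Differentiable ℝ (fun q : Spacetime => q.1) := by fun_prop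

lemma differentiable_coord (b : Fin 3) : Differentiable ℝ (fun q : Spacetime => q.2 b) := by
  fun_prop

lemma fieldD_time (i : FieldIndex) : fieldD i (fun q => q.1) p = (field i p).1 := by
  simp [fieldD, fderiv_fst]

lemma fieldD_coord (b : Fin 3) (i : FieldIndex) :
    fieldD i (fun q => q.2 b) p = (field i p).2 b := by
  have : HasFDerivAt (fun q : Spacetime => q.2 b)
      ((EuclideanSpace.proj b : EuclideanSpace ℝ (Fin 3) →L[ℝ] ℝ).comp
        (ContinuousLinearMap.snd ℝ ℝ (EuclideanSpace ℝ (Fin 3)))) p :=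
    ((EuclideanSpace.proj b : EuclideanSpace ℝ (Fin 3) →L[ℝ] ℝ).comp
        (ContinuousLinearMap.snd ℝ ℝ (EuclideanSpace ℝ (Fin 3)))).hasFDerivAt
  simp [fieldD, this.fderiv]

end rules

lemma field_coords (i : FieldIndex) (p : Spacetime) :
    ((field i p).1 = match i with
      | .inl α => if α = 0 then 1 else 0
      | .inr a => p.2 a) ∧
    ∀ b, ((field i p).2 b = match i with
      | .inl α => if α = b.succ then 1 else 0
      | .inr a => if a = b then p.1 else 0) := by
  rcases i with α | a
  · refine Fin.cases ?_ (fun a => ?_) α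
    · refine ⟨by simp [field, frameVec_zero], fun b => ?_⟩
      simp [field, frameVec_zero, (Fin.succ_ne_zero b).symm]
    · refine ⟨by simp [field, frameVec_succ], fun b => ?_⟩
      simp [field, frameVec_succ, eq_comm]
  · refine ⟨by simp [field, frameVec_zero, frameVec_succ], fun b => ?_⟩
    simp [field, frameVec_zero, frameVec_succ, eq_comm]

/-! ### Functions supported in the cone -/

/-- Functions of class `C^k` on the whole space-time whose support is contained in the cone. -/
structure ConeSupported (k : ℕ) (f : Spacetime → ℝ) : Prop where
  contDiff : ContDiff ℝ k f
  tsupport_subset : tsupport f ⊆ cone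

namespace ConeSupported

variable {k : ℕ} {f g : Spacetime → ℝ}

lemma mono {l : ℕ} (hf : ConeSupported k f) (h : l ≤ k) : ConeSupported l f :=
  ⟨hf.contDiff.of_le (by exact_mod_cast h), hf.tsupport_subset⟩

lemma add (hf : ConeSupported k f) (hg : ConeSupported k g) :
    ConeSupported k (fun p => f p + g p) :=
  ⟨hf.contDiff.add hg.contDiff,
    (tsupport_add f g).trans (Set.union_subset hf.tsupport_subset hg.tsupport_subset)⟩

lemma mul {c : Spacetime → ℝ} (hc : ContDiffOn ℝ ∞ c cone) (hf : ConeSupported k f) :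
    ConeSupported k (fun p => c p * f p) := by
  refine ⟨contDiff_iff_contDiffAt.2 fun p => ?_,
    (tsupport_mul_subset_right).trans hf.tsupport_subset⟩
  by_cases hp : p ∈ cone
  · have h1 : ContDiffAt ℝ k c p :=
      (hc.contDiffAt (isOpen_cone.mem_nhds hp)).of_le (by exact_mod_cast le_top)
    exact h1.mul hf.contDiff.contDiffAt
  · have h0 : f =ᶠ[𝓝 p] 0 := notMem_tsupport_iff_eventuallyEq.1 fun h => hp (hf.tsupport_subset h)
    have : (fun q => c q * f q) =ᶠ[𝓝 p] fun _ => 0 := by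
      filter_upwards [h0] with q hq
      simp [hq]
    exact contDiffAt_const.congr_of_eventuallyEq this

lemma fieldD (hf : ConeSupported (k + 1) f) (i : FieldIndex) :
    ConeSupported k (fieldD i f) := by
  constructor
  · have h1 : ContDiff ℝ k (fderiv ℝ f) := hf.contDiff.fderiv_right (by norm_cast)
    have h2 : ContDiff ℝ k (field i) := by
      rcases i with α | a
      · exact contDiff_const
      · change ContDiff ℝ k fun p : Spacetime => p.2 a • frameVec 0 + p.1 • frameVec a.succ
        fun_prop
    exact h1.clm_apply h2
  · refine (closure_minimal (fun p hp => ?_) (isClosed_tsupport _)).trans hf.tsupport_subset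
    by_contra h
    have h0 : f =ᶠ[𝓝 p] 0 := notMem_tsupport_iff_eventuallyEq.1 h
    apply hp
    simp [HypConformal.fieldD, h0.fderiv_eq]

lemma wordD {m : ℕ} (hf : ConeSupported m f) (W : List FieldIndex) (h : W.length + k ≤ m) :
    ConeSupported k (wordD W f) := by
  induction W generalizing k with
  | nil => exact hf.mono (by simpa using h)
  | cons i W ih => exact (ih (k := k + 1) (by simp at h; omega)).fieldD i

lemma differentiable (hf : ConeSupported (k + 1) f) : Differentiable ℝ f :=
  hf.contDiff.differentiable (by simp)

lemma eq_zero (hf : ConeSupported k f) {p : Spacetime} (hp : p ∉ cone) : f p = 0 :=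
  image_eq_zero_of_notMem_tsupport fun h => hp (hf.tsupport_subset h)

end ConeSupported

/-! ### Bounded coefficients -/

/-- The algebra of functions on the cone generated by the constants, `x^a/t`, `1/t` and
`t/s²`. All these functions are bounded on the cone; their values elsewhere are irrelevant. -/
inductive Coeff : (Spacetime → ℝ) → Prop
  | const (r : ℝ) : Coeff fun _ => r
  | dir (a : Fin 3) : Coeff fun p => p.2 a * p.1⁻¹
  | invTime : Coeff fun p => p.1⁻¹
  | ratio : Coeff fun p => p.1 * (p.1 ^ 2 - ∑ a, p.2 a ^ 2)⁻¹
  | add {c d} : Coeff c → Coeff d → Coeff fun p => c p + d p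
  | mul {c d} : Coeff c → Coeff d → Coeff fun p => c p * d p
  | congr {c d} : Coeff c → Set.EqOn d c cone → Coeff d

namespace Coeff

variable {c d : Spacetime → ℝ}

lemma neg (hc : Coeff c) : Coeff fun p => - c p :=
  ((const (-1)).mul hc).congr fun p _ => by simp

lemma sub (hc : Coeff c) (hd : Coeff d) : Coeff fun p => c p - d p :=
  (hc.add hd.neg).congr fun p _ => by simp [sub_eq_add_neg]

lemma contDiffOn (hc : Coeff c) : ContDiffOn ℝ ∞ c cone := by
  have ht : ∀ p ∈ cone, p.1 ≠ 0 := fun p hp => by linarith [cone_time_pos hp]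
  induction hc with
  | const r => exact contDiffOn_const
  | dir a => exact ContDiffOn.mul (by fun_prop) (ContDiffOn.inv (by fun_prop) ht)
  | invTime => exact ContDiffOn.inv (by fun_prop) ht
  | ratio =>
    refine ContDiffOn.mul (by fun_prop) (ContDiffOn.inv (by fun_prop) fun p hp => ?_)
    rw [← norm_sq_eq_sum]
    exact (cone_sq_pos hp).ne'
  | add _ _ h1 h2 => exact h1.add h2
  | mul _ _ h1 h2 => exact h1.mul h2
  | congr _ h ih => exact ih.congr h

lemma differentiableAt (hc : Coeff c) {p : Spacetime} (hp : p ∈ cone) :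
    DifferentiableAt ℝ c p :=
  (hc.contDiffOn.contDiffAt (isOpen_cone.mem_nhds hp)).differentiableAt (by simp)

lemma bounded (hc : Coeff c) : ∃ C : ℝ, 0 ≤ C ∧ ∀ p ∈ cone, |c p| ≤ C := by
  induction hc with
  | const r => exact ⟨|r|, abs_nonneg _, fun _ _ => le_rfl⟩
  | dir a =>
    refine ⟨1, zero_le_one, fun p hp => ?_⟩
    have h1 := cone_time_pos hp
    have h2 : ‖p.2‖ + 1 < p.1 := hp
    change |p.2 a * p.1⁻¹| ≤ 1
    rw [← div_eq_mul_inv, abs_div, abs_of_pos (by linarith : 0 < p.1), div_le_one (by linarith)]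
    linarith [abs_coord_le p.2 a]
  | invTime =>
    refine ⟨1, zero_le_one, fun p hp => ?_⟩
    have h1 := cone_time_pos hp
    rw [abs_inv, abs_of_pos (by linarith : 0 < p.1)]
    exact inv_le_one_of_one_le₀ h1.le
  | ratio =>
    refine ⟨1, zero_le_one, fun p hp => ?_⟩
    have h1 := cone_time_pos hp
    have h2 := cone_time_le_sq hp
    have h3 := cone_sq_pos hp
    change |p.1 * (p.1 ^ 2 - ∑ a, p.2 a ^ 2)⁻¹| ≤ 1
    rw [← norm_sq_eq_sum, ← div_eq_mul_inv, abs_div, abs_of_pos (by linarith : 0 < p.1),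
      abs_of_pos h3, div_le_one h3]
    exact h2
  | add _ _ h1 h2 =>
    obtain ⟨C, hC, h1⟩ := h1
    obtain ⟨D, hD, h2⟩ := h2
    exact ⟨C + D, by positivity, fun p hp => (abs_add_le _ _).trans (add_le_add (h1 p hp) (h2 p hp))⟩
  | mul _ _ h1 h2 =>
    obtain ⟨C, hC, h1⟩ := h1
    obtain ⟨D, hD, h2⟩ := h2
    refine ⟨C * D, by positivity, fun p hp => ?_⟩
    rw [abs_mul]
    exact mul_le_mul (h1 p hp) (h2 p hp) (abs_nonneg _) hC
  | congr _ h ih =>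
    obtain ⟨C, hC, h1⟩ := ih
    exact ⟨C, hC, fun p hp => by rw [h hp]; exact h1 p hp⟩

end Coeff

/-- Case analysis over `∂_t`, `∂_a`, `L_a`. -/
lemma fieldIndex_cases {motive : FieldIndex → Prop} (h0 : motive (.inl 0))
    (h1 : ∀ a : Fin 3, motive (.inl a.succ)) (h2 : ∀ a, motive (.inr a)) (i : FieldIndex) :
    motive i := by
  rcases i with α | a
  · exact Fin.cases h0 h1 α
  · exact h2 a

/-- The derivatives of `1/t` are multiples of `1/t`. -/
lemma exists_coeff_fieldD_invTime (i : FieldIndex) :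
    ∃ c, Coeff c ∧ ∀ p ∈ cone, fieldD i (fun q => q.1⁻¹) p = c p * p.1⁻¹ := by
  have key : ∀ p ∈ cone, fieldD i (fun q => q.1⁻¹) p = - (field i p).1 / p.1 ^ 2 := fun p hp => by
    rw [fieldD_inv (differentiable_time p) (by linarith [cone_time_pos hp]), fieldD_time]
  induction i using fieldIndex_cases with
  | h0 =>
    refine ⟨_, Coeff.invTime.neg, fun p hp => ?_⟩
    rw [key p hp, (field_coords _ p).1]
    have := cone_time_pos hp
    simp; field_simp
  | h1 a =>
    refine ⟨_, Coeff.const 0, fun p hp => ?_⟩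
    rw [key p hp, (field_coords _ p).1]
    simp
  | h2 a =>
    refine ⟨_, (Coeff.dir a).neg, fun p hp => ?_⟩
    rw [key p hp, (field_coords _ p).1]
    have := cone_time_pos hp
    simp; field_simp

lemma fieldD_dir (i : FieldIndex) (b : Fin 3) {p : Spacetime} (hp : p ∈ cone) :
    fieldD i (fun q => q.2 b * q.1⁻¹) p
      = (field i p).2 b * p.1⁻¹ - p.2 b * (field i p).1 / p.1 ^ 2 := by
  have h1 : p.1 ≠ 0 := by linarith [cone_time_pos hp]
  rw [fieldD_mul (g := fun q => q.1⁻¹) (differentiable_coord b p)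
      ((differentiable_time p).fun_inv h1),
    fieldD_inv (differentiable_time p) h1, fieldD_time, fieldD_coord]
  ring

lemma differentiable_quadratic :
    Differentiable ℝ (fun q : Spacetime => q.1 ^ 2 - ∑ a, q.2 a ^ 2) := by
  fun_prop

lemma fieldD_quadratic (i : FieldIndex) (p : Spacetime) :
    fieldD i (fun q => q.1 ^ 2 - ∑ a, q.2 a ^ 2) p
      = 2 * p.1 * (field i p).1 - ∑ a, 2 * p.2 a * (field i p).2 a := by
  have h : (fun q : Spacetime => q.1 ^ 2 - ∑ a, q.2 a ^ 2)
      = fun q => q.1 * q.1 + (-1) * (q.2 0 * q.2 0 + q.2 1 * q.2 1 + q.2 2 * q.2 2) := by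
    funext q; simp [Fin.sum_univ_three]; ring
  have d := differentiable_coord
  rw [h, fieldD_add (by fun_prop) (by fun_prop), fieldD_mul (by fun_prop) (by fun_prop),
    fieldD_mul (by fun_prop) (by fun_prop), fieldD_add (by fun_prop) (by fun_prop),
    fieldD_add (by fun_prop) (by fun_prop), fieldD_mul (d 0 p) (d 0 p), fieldD_mul (d 1 p) (d 1 p),
    fieldD_mul (d 2 p) (d 2 p), fieldD_const, fieldD_time, fieldD_coord, fieldD_coord,
    fieldD_coord, Fin.sum_univ_three]
  ring

/-- `s²` is invariant under the boosts. -/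
lemma fieldD_quadratic_cases (i : FieldIndex) (p : Spacetime) :
    fieldD i (fun q => q.1 ^ 2 - ∑ a, q.2 a ^ 2) p = match i with
      | .inl α => Fin.cases (motive := fun _ => ℝ) (2 * p.1) (fun a => -2 * p.2 a) α
      | .inr _ => 0 := by
  rw [fieldD_quadratic]
  simp only [field_coords]
  induction i using fieldIndex_cases with
  | h0 => simp [(Fin.succ_ne_zero _).symm]
  | h1 a => simp [Fin.succ_ne_zero]
  | h2 a => simp; ring

namespace Coeff

lemma fieldD {c : Spacetime → ℝ} (hc : Coeff c) (i : FieldIndex) : Coeff (fieldD i c) := by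
  induction hc with
  | const r => exact (const 0).congr fun p _ => fieldD_const r i
  | dir b =>
    induction i using fieldIndex_cases with
    | h0 =>
      refine ((dir b).mul invTime).neg.congr fun p hp => ?_
      simp only [fieldD_dir _ b hp, field_coords]
      simp [(Fin.succ_ne_zero _).symm]; ring
    | h1 a =>
      refine ((const (if a = b then 1 else 0)).mul invTime).congr fun p hp => ?_
      simp only [fieldD_dir _ b hp, field_coords]
      simp [Fin.succ_ne_zero]
    | h2 a =>
      refine ((const (if a = b then 1 else 0)).sub ((dir a).mul (dir b))).congr fun p hp => ?_
      simp only [fieldD_dir _ b hp, field_coords]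
      have := cone_time_pos hp
      split_ifs
      · field_simp
      · field_simp; ring
  | invTime =>
    obtain ⟨c, hc, h⟩ := exists_coeff_fieldD_invTime i
    exact (hc.mul invTime).congr h
  | ratio =>
    have key : ∀ p ∈ cone, HypConformal.fieldD i
        (fun q => q.1 * (q.1 ^ 2 - ∑ a, q.2 a ^ 2)⁻¹) p
        = (field i p).1 * (p.1 ^ 2 - ∑ a, p.2 a ^ 2)⁻¹
          - p.1 * (HypConformal.fieldD i (fun q => q.1 ^ 2 - ∑ a, q.2 a ^ 2) p)
            / (p.1 ^ 2 - ∑ a, p.2 a ^ 2) ^ 2 := fun p hp => by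
      have h1 : p.1 ^ 2 - ∑ a, p.2 a ^ 2 ≠ 0 := by
        rw [← norm_sq_eq_sum]; exact (cone_sq_pos hp).ne'
      rw [fieldD_mul (g := fun q => (q.1 ^ 2 - ∑ a, q.2 a ^ 2)⁻¹) (differentiable_time p)
          ((differentiable_quadratic p).fun_inv h1),
        fieldD_inv (differentiable_quadratic p) h1, fieldD_time]
      ring
    have h1 : ∀ p ∈ cone, p.1 ^ 2 - ∑ a, p.2 a ^ 2 ≠ 0 := fun p hp => by
      rw [← norm_sq_eq_sum]; exact (cone_sq_pos hp).ne'
    induction i using fieldIndex_cases with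
    | h0 =>
      refine ((invTime.mul ratio).sub ((const 2).mul (ratio.mul ratio))).congr fun p hp => ?_
      simp only [key p hp, fieldD_quadratic_cases, field_coords]
      have := cone_time_pos hp
      have := h1 p hp
      simp; field_simp
    | h1 a =>
      refine ((const 2).mul ((dir a).mul (ratio.mul ratio))).congr fun p hp => ?_
      simp only [key p hp, fieldD_quadratic_cases, field_coords]
      have := cone_time_pos hp
      have := h1 p hp
      simp [Fin.succ_ne_zero]; field_simp
    | h2 a =>
      refine ((dir a).mul ratio).congr fun p hp => ?_
      simp only [key p hp, fieldD_quadratic_cases, field_coords]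
      have := cone_time_pos hp
      have := h1 p hp
      simp; field_simp
  | add h1 h2 ih1 ih2 =>
    exact (ih1.add ih2).congr fun p hp => fieldD_add (h1.differentiableAt hp)
      (h2.differentiableAt hp) i
  | mul h1 h2 ih1 ih2 =>
    exact ((ih1.mul h2).add (h1.mul ih2)).congr fun p hp => fieldD_mul (h1.differentiableAt hp)
      (h2.differentiableAt hp) i
  | congr _ h ih => exact ih.congr (fieldD_congr h i)

end Coeff

/-! ### Commutators of the fields -/

section commutators

variable {w : Spacetime → ℝ} {p : Spacetime}

lemma pd_comm (hw : ConeSupported 2 w) (α β : Fin 4) : pd α (pd β w) = pd β (pd α w) := by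
  funext p
  have h1 : DifferentiableAt ℝ (fderiv ℝ w) p :=
    (hw.contDiff.fderiv_right (m := 1) (by norm_cast)).differentiable (by simp) p
  have h2 : IsSymmSndFDerivAt ℝ w p := hw.contDiff.contDiffAt.isSymmSndFDerivAt (by simp)
  have h3 : ∀ v v', fderiv ℝ (fun q => fderiv ℝ w q v) p v' = fderiv ℝ (fderiv ℝ w) p v' v :=
    fun v v' => by
      rw [fderiv_clm_apply h1 (by fun_prop)]
      simp
  change fderiv ℝ (fun q => fderiv ℝ w q (frameVec β)) p (frameVec α)
    = fderiv ℝ (fun q => fderiv ℝ w q (frameVec α)) p (frameVec β)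
  rw [h3, h3, h2.eq]

lemma fieldD_boost (hw : ConeSupported 2 w) (i : FieldIndex) (a : Fin 3) :
    fieldD i (boost a w) p = (field i p).2 a * pd 0 w p + p.2 a * fieldD i (pd 0 w) p
      + (field i p).1 * pd a.succ w p + p.1 * fieldD i (pd a.succ w) p := by
  have h : ∀ α, DifferentiableAt ℝ (pd α w) p := fun α => (hw.fieldD (.inl α)).differentiable p
  have h0 := differentiable_coord a p
  have h1 := differentiable_time p
  unfold boost
  rw [fieldD_add (h0.fun_mul (h 0)) (h1.fun_mul (h _)), fieldD_mul h0 (h 0), fieldD_mul h1 (h _),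
    fieldD_coord, fieldD_time]
  ring

/-- `[L_a, ∂_α]` is a constant multiple of a translation. -/
lemma boost_pd (hw : ConeSupported 2 w) (a : Fin 3) (α : Fin 4) :
    boost a (pd α w) p = pd α (boost a w) p
      - (if α = a.succ then 1 else 0) * pd 0 w p - (if α = 0 then 1 else 0) * pd a.succ w p := by
  have h := fieldD_boost (p := p) hw (.inl α) a
  rw [fieldD_inl, (field_coords _ p).1, (field_coords _ p).2, pd_comm hw α 0,
    pd_comm hw α a.succ] at h
  rw [h]
  simp only [boost]
  ring

lemma hypD_eq (b : Fin 3) (w : Spacetime → ℝ) :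
    hypD b w = fun p => p.2 b * p.1⁻¹ * pd 0 w p + pd b.succ w p := by
  funext p; simp [hypD, div_eq_mul_inv]

lemma hypD_eq_boost (b : Fin 3) (w : Spacetime → ℝ) (hp : p ∈ cone) :
    hypD b w p = p.1⁻¹ * boost b w p := by
  have := cone_time_pos hp
  simp only [hypD, boost]
  field_simp

lemma fieldD_hypD (hw : ConeSupported 2 w) (i : FieldIndex) (b : Fin 3) (hp : p ∈ cone) :
    fieldD i (hypD b w) p = fieldD i (fun q => q.2 b * q.1⁻¹) p * pd 0 w p
      + p.2 b * p.1⁻¹ * fieldD i (pd 0 w) p + fieldD i (pd b.succ w) p := by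
  have h : ∀ α, DifferentiableAt ℝ (pd α w) p := fun α => (hw.fieldD (.inl α)).differentiable p
  have h1 : DifferentiableAt ℝ (fun q : Spacetime => q.2 b * q.1⁻¹) p :=
    (Coeff.dir b).differentiableAt hp
  rw [hypD_eq, fieldD_add (h1.fun_mul (h 0)) (h _), fieldD_mul h1 (h 0)]

lemma pd_zero_hypD (hw : ConeSupported 2 w) (b : Fin 3) (hp : p ∈ cone) :
    pd 0 (hypD b w) p = hypD b (pd 0 w) p + - (p.2 b * p.1⁻¹) * (p.1⁻¹ * pd 0 w p) := by
  have h := fieldD_hypD hw (.inl 0) b hp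
  rw [fieldD_dir _ _ hp, (field_coords _ p).1, (field_coords _ p).2, fieldD_inl,
    pd_comm hw 0 b.succ] at h
  rw [h, hypD_eq]
  simp [(Fin.succ_ne_zero b).symm]
  ring

lemma pd_succ_hypD (hw : ConeSupported 2 w) (a b : Fin 3) (hp : p ∈ cone) :
    pd a.succ (hypD b w) p
      = hypD b (pd a.succ w) p + (if a = b then 1 else 0) * (p.1⁻¹ * pd 0 w p) := by
  have h := fieldD_hypD hw (.inl a.succ) b hp
  rw [fieldD_dir _ _ hp, (field_coords _ p).1, (field_coords _ p).2, fieldD_inl,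
    pd_comm hw a.succ b.succ, pd_comm hw a.succ 0] at h
  rw [h, hypD_eq]
  simp [Fin.succ_ne_zero]
  split_ifs <;> ring

lemma boost_hypD (hw : ConeSupported 2 w) (a b : Fin 3) (hp : p ∈ cone) :
    boost a (hypD b w) p = hypD b (boost a w) p + - (p.2 b * p.1⁻¹) * hypD a w p := by
  have h := fieldD_hypD hw (.inr a) b hp
  rw [fieldD_dir _ _ hp, (field_coords _ p).1, (field_coords _ p).2, fieldD_inr,
    boost_pd hw a 0, boost_pd hw a b.succ] at h
  rw [h, hypD_eq, hypD_eq]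
  have := cone_time_pos hp
  simp only [Fin.succ_ne_zero, (Fin.succ_ne_zero a).symm, Fin.succ_inj, if_false, if_true,
    eq_comm (a := b)]
  split_ifs <;> field_simp <;> ring

end commutators

/-! ### Operator classes -/

/-- Maps from functions to functions, such as words in differential operators. -/
abbrev Operator : Type := (Spacetime → ℝ) → Spacetime → ℝ

/-- Finite linear combinations, with coefficients in `A`, of operators in `G n`. They are only
required to agree with the operator on the cone, for `u` of class `C^R` supported in the cone.
Working with operators rather than functions makes every constant uniform in `u`. -/
inductive Comb (R : ℕ) (A : (Spacetime → ℝ) → Prop) (G : ℕ → Operator → Prop) (n : ℕ) :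
    Operator → Prop
  | gen {c g} : A c → G n g → Comb R A G n fun u p => c p * g u p
  | add {P Q} : Comb R A G n P → Comb R A G n Q → Comb R A G n fun u p => P u p + Q u p
  | congr {P Q} : Comb R A G n P →
      (∀ u, ConeSupported R u → Set.EqOn (Q u) (P u) cone) → Comb R A G n Q

/-- What is needed of a coefficient class for `Comb` to be stable under derivatives. -/
structure IsCoeffClass (A : (Spacetime → ℝ) → Prop) : Prop where
  one : A fun _ => 1
  mul : ∀ {c d}, A c → A d → A fun p => c p * d p
  contDiffOn : ∀ {c}, A c → ContDiffOn ℝ ∞ c cone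
  fieldD : ∀ {c}, A c → ∀ i, ∃ d, A d ∧ Set.EqOn (fieldD i c) d cone

lemma isCoeffClass_coeff : IsCoeffClass Coeff where
  one := .const 1
  mul := .mul
  contDiffOn := Coeff.contDiffOn
  fieldD hc i := ⟨_, hc.fieldD i, fun _ _ => rfl⟩

/-- Constant functions. -/
def IsConst (c : Spacetime → ℝ) : Prop := ∃ r : ℝ, c = fun _ => r

lemma isCoeffClass_isConst : IsCoeffClass IsConst where
  one := ⟨1, rfl⟩
  mul := by rintro _ _ ⟨r, rfl⟩ ⟨r', rfl⟩; exact ⟨r * r', rfl⟩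
  contDiffOn := by rintro _ ⟨r, rfl⟩; exact contDiffOn_const
  fieldD := by rintro _ ⟨r, rfl⟩ i; exact ⟨_, ⟨0, rfl⟩, fun p _ => fieldD_const r i⟩

/-- A family of operators, increasing in the order `n`, which map functions of class `C^R` to
functions of class `C^{N-n}`. -/
structure IsGenClass (R N : ℕ) (G : ℕ → Operator → Prop) : Prop where
  mono : ∀ {n g}, G n g → G (n + 1) g
  regular : ∀ {n k g}, n + k ≤ N → G n g → ∀ u, ConeSupported R u → ConeSupported k (g u)

namespace Comb

variable {R N n : ℕ} {A : (Spacetime → ℝ) → Prop} {G : ℕ → Operator → Prop} {P : Operator}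

lemma of_gen (hA : IsCoeffClass A) (h : G n P) : Comb R A G n P :=
  (gen hA.one h).congr fun u _ p _ => by simp

lemma mono (hG : IsGenClass R N G) (h : Comb R A G n P) : Comb R A G (n + 1) P := by
  induction h with
  | gen hc hg => exact gen hc (hG.mono hg)
  | add _ _ h1 h2 => exact h1.add h2
  | congr _ h ih => exact ih.congr h

lemma mul (hA : IsCoeffClass A) {c : Spacetime → ℝ} (hc : A c) (h : Comb R A G n P) :
    Comb R A G n fun u p => c p * P u p := by
  induction h with
  | gen hd hg => exact (gen (hA.mul hc hd) hg).congr fun u _ p _ => by ring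
  | add _ _ h1 h2 => exact (h1.add h2).congr fun u _ p _ => by ring
  | congr _ h ih => exact ih.congr fun u hu p hp => by simp [h u hu hp]

lemma exists_coneSupported (hA : IsCoeffClass A) (hG : IsGenClass R N G) (h : Comb R A G n P)
    {k : ℕ} (hk : n + k ≤ N) {u : Spacetime → ℝ} (hu : ConeSupported R u) :
    ∃ f, ConeSupported k f ∧ Set.EqOn (P u) f cone := by
  induction h with
  | gen hc hg => exact ⟨_, (hG.regular hk hg u hu).mul (hA.contDiffOn hc), fun _ _ => rfl⟩
  | add _ _ h1 h2 =>
    obtain ⟨f, hf, h1⟩ := h1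
    obtain ⟨g, hg, h2⟩ := h2
    exact ⟨_, hf.add hg, fun p hp => by simp [h1 hp, h2 hp]⟩
  | congr _ h ih =>
    obtain ⟨f, hf, h1⟩ := ih
    exact ⟨f, hf, (h u hu).trans h1⟩

lemma differentiableAt (hA : IsCoeffClass A) (hG : IsGenClass R N G) (h : Comb R A G n P)
    (hn : n + 1 ≤ N) {u : Spacetime → ℝ} (hu : ConeSupported R u) {p : Spacetime}
    (hp : p ∈ cone) : DifferentiableAt ℝ (P u) p := by
  obtain ⟨f, hf, h⟩ := h.exists_coneSupported hA hG hn hu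
  exact (ConeSupported.differentiable (k := 0) hf p).congr_of_eventuallyEq
    (h.eventuallyEq_of_mem (isOpen_cone.mem_nhds hp))

/-- If a field maps the generators of order `n` into combinations of order `n + 1`, then it maps
all combinations of order `n` into combinations of order `n + 1`. -/
lemma fieldD (hA : IsCoeffClass A) (hG : IsGenClass R N G) (i : FieldIndex)
    (hi : ∀ g, G n g → Comb R A G (n + 1) fun u => fieldD i (g u)) (hn : n + 1 ≤ N)
    (h : Comb R A G n P) : Comb R A G (n + 1) fun u => HypConformal.fieldD i (P u) := by
  induction h with
  | @gen c g hc hg =>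
    obtain ⟨d, hd, hcd⟩ := hA.fieldD hc i
    refine ((gen hd (hG.mono hg)).add ((hi _ hg).mul hA hc)).congr fun u hu p hp => ?_
    have h1 : DifferentiableAt ℝ c p :=
      ((hA.contDiffOn hc).contDiffAt (isOpen_cone.mem_nhds hp)).differentiableAt (by simp)
    rw [fieldD_mul h1 ((of_gen hA hg).differentiableAt hA hG hn hu hp), hcd hp]
  | add h1 h2 ih1 ih2 =>
    exact (ih1.add ih2).congr fun u hu p hp =>
      fieldD_add (h1.differentiableAt hA hG hn hu hp) (h2.differentiableAt hA hG hn hu hp) i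
  | congr _ h ih => exact ih.congr fun u hu => fieldD_congr (h u hu) i

end Comb

/-- A generator class whose bounded combinations are stable under all fields. -/
structure IsStableClass (R N : ℕ) (G : ℕ → Operator → Prop) : Prop extends IsGenClass R N G where
  fieldD_gen : ∀ {n g}, n + 1 ≤ N → G n g → ∀ i, Comb R Coeff G (n + 1) fun u => fieldD i (g u)

namespace Comb

variable {R N n : ℕ} {G : ℕ → Operator → Prop} {P : Operator}

lemma fieldD_of_stable (hG : IsStableClass R N G) (i : FieldIndex) (hn : n + 1 ≤ N)
    (h : Comb R Coeff G n P) : Comb R Coeff G (n + 1) fun u => HypConformal.fieldD i (P u) :=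
  h.fieldD isCoeffClass_coeff hG.toIsGenClass i (fun _ hg => hG.fieldD_gen hn hg i) hn

lemma wordD_of_stable (hG : IsStableClass R N G) (W : List FieldIndex) (hn : W.length + n ≤ N)
    (h : Comb R Coeff G n P) : Comb R Coeff G (W.length + n) fun u => wordD W (P u) := by
  induction W with
  | nil => simpa [wordD] using h
  | cons i W ih =>
    have hl : (i :: W).length + n = W.length + n + 1 := by simp; omega
    rw [hl] at hn ⊢
    exact (ih (by omega)).fieldD_of_stable hG i hn

/-- The class of operators `P` for which `t P` is a combination of order `n` is also stable,
because `t Z P = Z (t P) - (Z t / t) (t P)`. -/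
lemma time_mul_fieldD (hG : IsStableClass R N G) (i : FieldIndex) (hn : n + 1 ≤ N)
    (h : Comb R Coeff G n fun u p => p.1 * P u p) :
    Comb R Coeff G (n + 1) fun u p => p.1 * HypConformal.fieldD i (P u) p := by
  obtain ⟨c, hc, hci⟩ := exists_coeff_fieldD_invTime i
  refine (((h.mono hG.toIsGenClass).mul isCoeffClass_coeff hc).add
    (h.fieldD_of_stable hG i hn)).congr fun u hu p hp => ?_
  have hp1 := cone_time_pos hp
  have h1 : Set.EqOn (P u) (fun q => q.1⁻¹ * (q.1 * P u q)) cone := fun q hq => by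
    have := cone_time_pos hq
    simp only
    field_simp
  dsimp only
  rw [fieldD_congr h1 i hp, fieldD_mul (Coeff.invTime.differentiableAt hp)
    (h.differentiableAt isCoeffClass_coeff hG.toIsGenClass hn hu hp), hci p hp]
  field_simp

lemma time_mul_wordD (hG : IsStableClass R N G) (W : List FieldIndex) (hn : W.length + n ≤ N)
    (h : Comb R Coeff G n fun u p => p.1 * P u p) :
    Comb R Coeff G (W.length + n) fun u p => p.1 * wordD W (P u) p := by
  induction W with
  | nil => simpa [wordD] using h
  | cons i W ih =>
    have hl : (i :: W).length + n = W.length + n + 1 := by simp; omega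
    rw [hl] at hn ⊢
    exact (ih (by omega)).time_mul_fieldD hG i hn

end Comb

/-! ### Normal ordering of words -/

/-- The words `∂^I L^J` with `|I| + |J| ≤ n`. -/
inductive OrderedWord : ℕ → Operator → Prop
  | mk {n} (I J) (h : List.length I + List.length J ≤ n) : OrderedWord n (derivWord I J)

lemma ConeSupported.derivWord {m k : ℕ} {u : Spacetime → ℝ} (hu : ConeSupported m u)
    (I : List (Fin 4)) (J : List (Fin 3)) (h : I.length + J.length + k ≤ m) :
    ConeSupported k (derivWord I J u) := by
  rw [derivWord_eq_wordD]
  exact hu.wordD _ (by simpa using h)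

lemma isGenClass_orderedWord (R : ℕ) : IsGenClass R R OrderedWord where
  mono := by rintro n g ⟨I, J, h⟩; exact ⟨I, J, by omega⟩
  regular := by rintro n k g hk ⟨I, J, h⟩ u hu; exact hu.derivWord I J (by omega)

lemma comb_pd_orderedWord {R n : ℕ} (α : Fin 4) {g : Operator} (hg : OrderedWord n g) :
    Comb R IsConst OrderedWord (n + 1) fun u => fieldD (.inl α) (g u) := by
  obtain ⟨I, J, h⟩ := hg
  exact .of_gen isCoeffClass_isConst ⟨α :: I, J, by simp; omega⟩

lemma comb_boost_orderedWord {R : ℕ} (a : Fin 3) (I : List (Fin 4)) (J : List (Fin 3)) {n : ℕ}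
    (h : I.length + J.length ≤ n) (hn : n + 1 ≤ R) :
    Comb R IsConst OrderedWord (n + 1) fun u => fieldD (.inr a) (derivWord I J u) := by
  induction I generalizing n with
  | nil =>
    rw [fieldD_inr]
    exact .of_gen isCoeffClass_isConst ⟨[], a :: J, by simp at h ⊢; omega⟩
  | cons α I ih =>
    obtain ⟨m, rfl⟩ : ∃ m, n = m + 1 := ⟨n - 1, by simp at h; omega⟩
    simp only [List.length_cons] at h
    have h1 := (ih (n := m) (by omega) (by omega)).fieldD isCoeffClass_isConst
      (isGenClass_orderedWord R) (.inl α) (fun g hg => comb_pd_orderedWord α hg) hn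
    have h2 : ∀ β r, Comb R IsConst OrderedWord (m + 1 + 1) fun u p =>
        r * derivWord (β :: I) J u p := fun β r =>
      .gen (c := fun _ => r) ⟨r, rfl⟩ ⟨β :: I, J, by simp; omega⟩
    refine ((h1.add (h2 0 (-(if α = a.succ then 1 else 0)))).add
      (h2 a.succ (-(if α = 0 then 1 else 0)))).congr fun u hu p _ => ?_
    have hw : ConeSupported 2 (derivWord I J u) := hu.derivWord I J (by omega)
    have := boost_pd (p := p) hw a α
    rw [fieldD_inr]
    change boost a (pd α (derivWord I J u)) p = pd α (boost a (derivWord I J u)) p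
      + _ * pd 0 (derivWord I J u) p + _ * pd a.succ (derivWord I J u) p
    rw [this]
    ring

/-- Every word in the fields is a combination, with constant coefficients, of words of at most the
same order in which the translations stand on the left of the boosts. -/
lemma comb_wordD_orderedWord {R : ℕ} (W : List FieldIndex) (h : W.length ≤ R) :
    Comb R IsConst OrderedWord W.length (wordD W) := by
  induction W with
  | nil => exact .of_gen isCoeffClass_isConst ⟨[], [], by simp⟩
  | cons i W ih =>
    simp only [List.length_cons] at h ⊢
    refine (ih (by omega)).fieldD isCoeffClass_isConst (isGenClass_orderedWord R) i
      (fun g hg => ?_) h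
    rcases i with α | a
    · exact comb_pd_orderedWord α hg
    · obtain ⟨I, J, hIJ⟩ := hg
      exact comb_boost_orderedWord a I J hIJ h

/-! ### The three families of operators -/

/-- Words of order at most `n` in the fields. -/
inductive WordClass : ℕ → Operator → Prop
  | word {n} (W) (h : List.length W ≤ n) : WordClass n (wordD W)

/-- The operators `∂̲_a Z^W` and `t⁻¹ Z^W`, where `Z^W` is a word of order at most `n`. -/
inductive TangentialClass : ℕ → Operator → Prop
  | deriv {n} (a W) (h : List.length W ≤ n) : TangentialClass n fun u => hypD a (wordD W u)
  | lower {n} (W) (h : List.length W ≤ n) : TangentialClass n fun u p => p.1⁻¹ * wordD W u p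

/-- The operators `(s/t) ∂_α Z^W` and `s⁻¹ Z^W`, where `Z^W` is a word of order at most `n`. -/
inductive TransversalClass : ℕ → Operator → Prop
  | deriv {n} (α W) (h : List.length W ≤ n) :
    TransversalClass n fun u p => hypTime p / p.1 * pd α (wordD W u) p
  | lower {n} (W) (h : List.length W ≤ n) :
    TransversalClass n fun u p => (hypTime p)⁻¹ * wordD W u p

lemma contDiffOn_hypTime : ContDiffOn ℝ ∞ hypTime cone := by
  have h : ContDiffOn ℝ ∞ (fun p : Spacetime => p.1 ^ 2 - ‖p.2‖ ^ 2) cone :=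
    ((contDiff_fst.pow 2).sub (contDiff_snd.norm_sq ℝ)).contDiffOn
  exact h.sqrt fun p hp => (cone_sq_pos hp).ne'

lemma contDiffOn_invHypTime : ContDiffOn ℝ ∞ (fun p => (hypTime p)⁻¹) cone :=
  contDiffOn_hypTime.inv fun _ hp => (hypTime_pos hp).ne'

lemma contDiffOn_hypTime_div : ContDiffOn ℝ ∞ (fun p => hypTime p / p.1) cone :=
  contDiffOn_hypTime.div contDiff_fst.contDiffOn fun p hp => by linarith [cone_time_pos hp]

lemma ConeSupported.hypD {k : ℕ} {f : Spacetime → ℝ} (hf : ConeSupported (k + 1) f) (a : Fin 3) :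
    ConeSupported k (hypD a f) := by
  rw [hypD_eq]
  exact ((hf.fieldD (.inl 0)).mul (Coeff.dir a).contDiffOn).add (hf.fieldD (.inl a.succ))

lemma isStableClass_word (N : ℕ) : IsStableClass (N + 1) N WordClass where
  mono := by rintro n g ⟨W, h⟩; exact ⟨W, by omega⟩
  regular := by rintro n k g hk ⟨W, h⟩ u hu; exact hu.wordD W (by omega)
  fieldD_gen := by
    rintro n g hn ⟨W, h⟩ i
    exact .of_gen isCoeffClass_coeff ⟨i :: W, by simpa using h⟩

lemma isStableClass_tangential (N : ℕ) : IsStableClass (N + 1) N TangentialClass where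
  mono := by
    rintro n g (⟨a, W, h⟩ | ⟨W, h⟩)
    · exact .deriv a W (by omega)
    · exact .lower W (by omega)
  regular := by
    rintro n k g hk (⟨a, W, h⟩ | ⟨W, h⟩) u hu
    · exact (hu.wordD (k := k + 1) W (by omega)).hypD a
    · exact (hu.wordD W (by omega)).mul Coeff.invTime.contDiffOn
  fieldD_gen := by
    rintro n g hn (⟨b, W, h⟩ | ⟨W, h⟩) i
    · have hw : ∀ u, ConeSupported (N + 1) u → ConeSupported 2 (wordD W u) := fun u hu =>
        hu.wordD W (by omega)
      have h1 : ∀ i b, TangentialClass (n + 1) fun u => hypD b (wordD (i :: W) u) :=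
        fun i b => .deriv b (i :: W) (by simpa using h)
      have h2 : TangentialClass (n + 1) fun u p => p.1⁻¹ * pd 0 (wordD W u) p :=
        .lower (.inl 0 :: W) (by simpa using h)
      have h1' := fun i b => Comb.of_gen (R := N + 1) isCoeffClass_coeff (h1 i b)
      induction i using fieldIndex_cases with
      | h0 =>
        exact ((h1' (.inl 0) b).add (.gen (Coeff.dir b).neg h2)).congr
          fun u hu p hp => pd_zero_hypD (hw u hu) b hp
      | h1 a =>
        exact ((h1' (.inl a.succ) b).add (.gen (Coeff.const (if a = b then 1 else 0)) h2)).congr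
          fun u hu p hp => pd_succ_hypD (hw u hu) a b hp
      | h2 a =>
        refine ((h1' (.inr a) b).add (.gen (Coeff.dir b).neg
          (.deriv a W (by omega) : TangentialClass (n + 1) _))).congr fun u hu p hp => ?_
        simp only [wordD, List.foldr_cons, fieldD_inr]
        exact boost_hypD (hw u hu) a b hp
    · obtain ⟨c, hc, hci⟩ := exists_coeff_fieldD_invTime i
      refine ((Comb.gen hc (.lower W (by omega) : TangentialClass (n + 1) _)).add
        (.of_gen isCoeffClass_coeff (.lower (i :: W) (by simpa using h)))).congr
          fun u hu p hp => ?_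
      have hw : ConeSupported 1 (wordD W u) := hu.wordD W (by omega)
      rw [fieldD_mul (Coeff.invTime.differentiableAt hp)
        (ConeSupported.differentiable (k := 0) hw p), hci p hp]
      simp only [wordD, List.foldr_cons]
      ring

/-- `Z s = q t/s` with a coefficient `q`: it is `1` for `∂_t`, `-x^a/t` for `∂_a`, and `0` for the
boosts. -/
lemma exists_coeff_fieldD_hypTime (i : FieldIndex) :
    ∃ q, Coeff q ∧ ∀ p ∈ cone, fieldD i hypTime p = q p * (p.1 / hypTime p) := by
  have key : ∀ p ∈ cone, fieldD i hypTime p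
      = fieldD i (fun q => q.1 ^ 2 - ∑ a, q.2 a ^ 2) p / (2 * hypTime p) := fun p hp => by
    have h0 := hypTime_pos hp
    have hd : DifferentiableAt ℝ hypTime p :=
      (contDiffOn_hypTime.contDiffAt (isOpen_cone.mem_nhds hp)).differentiableAt (by simp)
    have h1 : Set.EqOn (fun q : Spacetime => q.1 ^ 2 - ∑ a, q.2 a ^ 2)
        (fun q => hypTime q * hypTime q) cone := fun q hq => by
      simp only [← pow_two, hypTime_sq hq, norm_sq_eq_sum]
    rw [fieldD_congr h1 i hp, fieldD_mul hd hd]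
    field_simp
    ring
  induction i using fieldIndex_cases with
  | h0 =>
    refine ⟨_, .const 1, fun p hp => ?_⟩
    rw [key p hp, fieldD_quadratic_cases]
    have := hypTime_pos hp
    simp only [Fin.cases_zero]
    field_simp
  | h1 a =>
    refine ⟨_, (Coeff.dir a).neg, fun p hp => ?_⟩
    rw [key p hp, fieldD_quadratic_cases]
    have := cone_time_pos hp
    have := hypTime_pos hp
    simp only [Fin.cases_succ]
    field_simp
  | h2 a =>
    refine ⟨_, .const 0, fun p hp => ?_⟩
    rw [key p hp, fieldD_quadratic_cases]
    simp

lemma differentiableAt_hypTime {p : Spacetime} (hp : p ∈ cone) : DifferentiableAt ℝ hypTime p :=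
  (contDiffOn_hypTime.contDiffAt (isOpen_cone.mem_nhds hp)).differentiableAt (by simp)

/-- `Z s⁻¹` is a multiple of `s⁻¹`, because `t/s²` is bounded in the cone. -/
lemma exists_coeff_fieldD_invHypTime (i : FieldIndex) :
    ∃ c, Coeff c ∧ ∀ p ∈ cone, fieldD i (fun q => (hypTime q)⁻¹) p = c p * (hypTime p)⁻¹ := by
  obtain ⟨q, hq, hqi⟩ := exists_coeff_fieldD_hypTime i
  refine ⟨_, (hq.mul Coeff.ratio).neg, fun p hp => ?_⟩
  have := hypTime_pos hp
  rw [fieldD_inv (differentiableAt_hypTime hp) this.ne', hqi p hp, ← norm_sq_eq_sum,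
    ← hypTime_sq hp]
  field_simp

/-- `(s/t)² = 1 - |x|²/t²` is a coefficient. -/
lemma coeff_hypTime_div_sq : Coeff fun p => (hypTime p / p.1) ^ 2 := by
  have h := fun a => (Coeff.dir a).mul (Coeff.dir a)
  refine ((Coeff.const 1).sub (((h 0).add (h 1)).add (h 2))).congr fun p hp => ?_
  have := cone_time_pos hp
  simp only [div_pow, hypTime_sq hp, norm_sq_eq_sum, Fin.sum_univ_three]
  field_simp

/-- The derivatives of `s/t` are combinations of `s/t` and `1/s`. -/
lemma exists_coeff_fieldD_hypTime_div (i : FieldIndex) :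
    ∃ c d, Coeff c ∧ Coeff d ∧ ∀ p ∈ cone,
      fieldD i (fun q => hypTime q / q.1) p = c p * (hypTime p / p.1) + d p * (hypTime p)⁻¹ := by
  obtain ⟨c, hc, hci⟩ := exists_coeff_fieldD_invTime i
  obtain ⟨q, hq, hqi⟩ := exists_coeff_fieldD_hypTime i
  refine ⟨c, q, hc, hq, fun p hp => ?_⟩
  have h1 := hypTime_pos hp
  have h2 := cone_time_pos hp
  simp only [div_eq_mul_inv]
  rw [fieldD_mul (differentiableAt_hypTime hp) (Coeff.invTime.differentiableAt hp), hqi p hp,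
    hci p hp]
  field_simp
  ring

lemma isStableClass_transversal (N : ℕ) : IsStableClass (N + 1) N TransversalClass where
  mono := by
    rintro n g (⟨α, W, h⟩ | ⟨W, h⟩)
    · exact .deriv α W (by omega)
    · exact .lower W (by omega)
  regular := by
    rintro n k g hk (⟨α, W, h⟩ | ⟨W, h⟩) u hu
    · exact ((hu.wordD (k := k + 1) W (by omega)).fieldD (.inl α)).mul contDiffOn_hypTime_div
    · exact (hu.wordD W (by omega)).mul contDiffOn_invHypTime
  fieldD_gen := by
    rintro n g hn (⟨α, W, h⟩ | ⟨W, h⟩) i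
    · have hw : ∀ u, ConeSupported (N + 1) u → ConeSupported 2 (wordD W u) := fun u hu =>
        hu.wordD W (by omega)
      obtain ⟨c, d, hc, hd, hcd⟩ := exists_coeff_fieldD_hypTime_div i
      have h1 : ∀ i α, TransversalClass (n + 1) fun u p =>
          hypTime p / p.1 * pd α (wordD (i :: W) u) p :=
        fun i α => .deriv α (i :: W) (by simpa using h)
      have h2 : ∀ α, TransversalClass (n + 1) fun u p => hypTime p / p.1 * pd α (wordD W u) p :=
        fun α => .deriv α W (by omega)
      have h3 : TransversalClass (n + 1) fun u p => (hypTime p)⁻¹ * pd α (wordD W u) p :=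
        .lower (.inl α :: W) (by simpa using h)
      have hA := isCoeffClass_coeff
      -- the part in which the derivative falls on the coefficient
      have h4 : Comb (N + 1) Coeff TransversalClass (n + 1) fun u p =>
          fieldD i (fun q => hypTime q / q.1) p * pd α (wordD W u) p :=
        ((Comb.gen hc (h2 α)).add (.gen hd h3)).congr fun u hu p hp => by
          simp only [hcd p hp]; ring
      have h5 : ∀ u, ConeSupported (N + 1) u → ∀ p ∈ cone,
          fieldD i (fun q => hypTime q / q.1 * pd α (wordD W u) q) p
            = fieldD i (fun q => hypTime q / q.1) p * pd α (wordD W u) p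
              + hypTime p / p.1 * fieldD i (pd α (wordD W u)) p := fun u hu p hp => by
        rw [fieldD_mul (g := pd α (wordD W u)) ((contDiffOn_hypTime_div.contDiffAt
          (isOpen_cone.mem_nhds hp)).differentiableAt (by simp))
          (ConeSupported.differentiable (k := 0) ((hw u hu).fieldD (.inl α)) p)]
      rcases i with β | a
      · refine (h4.add (.of_gen hA (h1 (.inl β) α))).congr fun u hu p hp => ?_
        rw [h5 u hu p hp, fieldD_inl, pd_comm (hw u hu)]
        rfl
      · refine (h4.add (((Comb.of_gen hA (h1 (.inr a) α)).add
          (.gen (.const (-(if α = a.succ then 1 else 0))) (h2 0))).add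
          (.gen (.const (-(if α = 0 then 1 else 0))) (h2 a.succ)))).congr fun u hu p hp => ?_
        have h6 := boost_pd (p := p) (hw u hu) a α
        rw [h5 u hu p hp]
        simp only [fieldD_inr, wordD, List.foldr_cons] at h6 ⊢
        rw [h6]
        ring
    · obtain ⟨c, hc, hci⟩ := exists_coeff_fieldD_invHypTime i
      refine ((Comb.gen hc (.lower W (by omega) : TransversalClass (n + 1) _)).add
        (.of_gen isCoeffClass_coeff (.lower (i :: W) (by simpa using h)))).congr
          fun u hu p hp => ?_
      have hw : ConeSupported 1 (wordD W u) := hu.wordD W (by omega)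
      rw [fieldD_mul ((contDiffOn_invHypTime.contDiffAt
          (isOpen_cone.mem_nhds hp)).differentiableAt (by simp))
        (ConeSupported.differentiable (k := 0) hw p), hci p hp]
      simp only [wordD, List.foldr_cons]
      ring

/-! ### The differential expressions to be estimated -/

section membership

variable {N : ℕ} (W W' : List FieldIndex)

lemma comb_wordD_hypD (a : Fin 3) (h : W.length + W'.length ≤ N) :
    Comb (N + 1) Coeff TangentialClass (W.length + W'.length)
      fun u => wordD W (hypD a (wordD W' u)) :=
  Comb.wordD_of_stable (isStableClass_tangential N) W h
    (.of_gen isCoeffClass_coeff (.deriv a W' le_rfl))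

lemma comb_wordD_hypDs (h : W.length + W'.length ≤ N) :
    Comb (N + 1) Coeff TransversalClass (W.length + W'.length)
      fun u => wordD W (hypDs (wordD W' u)) :=
  Comb.wordD_of_stable (isStableClass_transversal N) W h
    (.of_gen isCoeffClass_coeff (.deriv 0 W' le_rfl))

/-- `t ∂̲_a ∂̲_b = ∂̲_a L_b - (x^a/t) t⁻¹ L_b`. -/
lemma comb_time_mul_hypD_hypD (a b : Fin 3) (h : W'.length + 1 ≤ N) :
    Comb (N + 1) Coeff TangentialClass (W'.length + 1)
      fun u p => p.1 * hypD a (hypD b (wordD W' u)) p := by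
  refine ((Comb.of_gen isCoeffClass_coeff (.deriv a (.inr b :: W') (by simp))).add
    (.gen (Coeff.dir a).neg (.lower (.inr b :: W') (by simp)))).congr fun u hu p hp => ?_
  have hw : ConeSupported 1 (boost b (wordD W' u)) :=
    fieldD_inr b ▸ (hu.wordD (k := 2) W' (by omega)).fieldD (.inr b)
  have hd := ConeSupported.differentiable (k := 0) hw p
  have h1 : Set.EqOn (hypD b (wordD W' u)) (fun q => q.1⁻¹ * boost b (wordD W' u) q) cone :=
    fun q hq => hypD_eq_boost b _ hq
  have h0 := cone_time_pos hp
  have hboost : wordD (.inr b :: W') = fun u => boost b (wordD W' u) := by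
    funext u; rw [← fieldD_inr]; rfl
  simp only [hboost]
  rw [hypD_eq_boost a _ hp, hypD_eq_boost a _ hp, ← fieldD_inr a, fieldD_congr h1 _ hp,
    fieldD_mul (Coeff.invTime.differentiableAt hp) hd,
    fieldD_inv (differentiable_time p) (by linarith), fieldD_time, (field_coords _ p).1]
  field_simp
  ring

/-- `t ∂̲_s ∂̲_a = ∂̲_s L_a - (s/t)² s⁻¹ L_a`. -/
lemma comb_time_mul_hypDs_hypD (a : Fin 3) (h : W'.length + 1 ≤ N) :
    Comb (N + 1) Coeff TransversalClass (W'.length + 1)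
      fun u p => p.1 * hypDs (hypD a (wordD W' u)) p := by
  refine ((Comb.of_gen isCoeffClass_coeff (.deriv 0 (.inr a :: W') (by simp))).add
    (.gen coeff_hypTime_div_sq.neg (.lower (.inr a :: W') (by simp)))).congr fun u hu p hp => ?_
  have hw : ConeSupported 1 (boost a (wordD W' u)) :=
    fieldD_inr a ▸ (hu.wordD (k := 2) W' (by omega)).fieldD (.inr a)
  have hd := ConeSupported.differentiable (k := 0) hw p
  have h1 : Set.EqOn (hypD a (wordD W' u)) (fun q => q.1⁻¹ * boost a (wordD W' u) q) cone :=
    fun q hq => hypD_eq_boost a _ hq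
  have h0 := cone_time_pos hp
  have h2 := hypTime_pos hp
  have hboost : wordD (.inr a :: W') = fun u => boost a (wordD W' u) := by
    funext u; rw [← fieldD_inr]; rfl
  simp only [hboost, hypDs]
  rw [← fieldD_inl, fieldD_congr h1 _ hp,
    fieldD_mul (Coeff.invTime.differentiableAt hp) hd,
    fieldD_inv (differentiable_time p) (by linarith), fieldD_time, (field_coords _ p).1]
  simp only [if_true]
  field_simp
  ring

lemma comb_time_mul_wordD_hypD_hypD (a b : Fin 3) (h : W.length + (W'.length + 1) ≤ N) :
    Comb (N + 1) Coeff TangentialClass (W.length + (W'.length + 1))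
      fun u p => p.1 * wordD W (hypD a (hypD b (wordD W' u))) p :=
  Comb.time_mul_wordD (isStableClass_tangential N) W h
    (comb_time_mul_hypD_hypD W' a b (by omega))

lemma comb_time_mul_wordD_hypDs_hypD (a : Fin 3) (h : W.length + (W'.length + 1) ≤ N) :
    Comb (N + 1) Coeff TransversalClass (W.length + (W'.length + 1))
      fun u p => p.1 * wordD W (hypDs (hypD a (wordD W' u))) p :=
  Comb.time_mul_wordD (isStableClass_transversal N) W h
    (comb_time_mul_hypDs_hypD W' a (by omega))

end membership

/-! ### The energy density -/

/-- The integrand of the conformal energy together with the term `((s/t) w)²`, whose integral is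
controlled by Hardy's inequality. -/
def density (w : Spacetime → ℝ) (p : Spacetime) : ℝ :=
  (∑ a : Fin 3, (hypTime p * hypD a w p) ^ 2) + (opK w p + 2 * w p) ^ 2
    + (hypTime p / p.1 * w p) ^ 2

/-- The sum of a quantity over all pairs of words with `|I| + |J| ≤ N`. -/
def wordSum (N : ℕ) (F : List (Fin 4) → List (Fin 3) → ℝ) : ℝ :=
  ∑ i ∈ Finset.range (N + 1), ∑ j ∈ Finset.range (N + 1 - i),
    ∑ I : Fin i → Fin 4, ∑ J : Fin j → Fin 3, F (List.ofFn I) (List.ofFn J)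

/-- The sum of the densities of all `∂^I L^J u` with `|I| + |J| ≤ N`. -/
def totalDensity (N : ℕ) (u : Spacetime → ℝ) (p : Spacetime) : ℝ :=
  wordSum N fun I J => density (derivWord I J u) p

lemma wordSum_nonneg {N : ℕ} {F : List (Fin 4) → List (Fin 3) → ℝ} (hF : ∀ I J, 0 ≤ F I J) :
    0 ≤ wordSum N F :=
  Finset.sum_nonneg fun _ _ => Finset.sum_nonneg fun _ _ => Finset.sum_nonneg fun _ _ =>
    Finset.sum_nonneg fun _ _ => hF _ _

lemma le_wordSum {N : ℕ} {F : List (Fin 4) → List (Fin 3) → ℝ} (hF : ∀ I J, 0 ≤ F I J)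
    {I : List (Fin 4)} {J : List (Fin 3)} (h : I.length + J.length ≤ N) :
    F I J ≤ wordSum N F := by
  have h4 : F I J ≤ ∑ J' : Fin J.length → Fin 3, F (List.ofFn I.get) (List.ofFn J') := by
    have := Finset.single_le_sum (f := fun J' : Fin J.length → Fin 3 =>
      F (List.ofFn I.get) (List.ofFn J')) (fun _ _ => hF _ _) (Finset.mem_univ J.get)
    simpa using this
  have h3 := Finset.single_le_sum (f := fun I' : Fin I.length → Fin 4 =>
      ∑ J' : Fin J.length → Fin 3, F (List.ofFn I') (List.ofFn J'))
    (fun _ _ => Finset.sum_nonneg fun _ _ => hF _ _) (Finset.mem_univ I.get)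
  have h2 := Finset.single_le_sum (s := Finset.range (N + 1 - I.length)) (f := fun j =>
      ∑ I' : Fin I.length → Fin 4, ∑ J' : Fin j → Fin 3, F (List.ofFn I') (List.ofFn J'))
    (fun _ _ => Finset.sum_nonneg fun _ _ => Finset.sum_nonneg fun _ _ => hF _ _)
    (Finset.mem_range.2 (by omega : J.length < N + 1 - I.length))
  have h1 := Finset.single_le_sum (s := Finset.range (N + 1)) (f := fun i =>
      ∑ j ∈ Finset.range (N + 1 - i), ∑ I' : Fin i → Fin 4, ∑ J' : Fin j → Fin 3,
        F (List.ofFn I') (List.ofFn J'))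
    (fun _ _ => Finset.sum_nonneg fun _ _ => Finset.sum_nonneg fun _ _ =>
      Finset.sum_nonneg fun _ _ => hF _ _)
    (Finset.mem_range.2 (by omega : I.length < N + 1))
  exact h4.trans (h3.trans (h2.trans h1))

lemma wordSum_mono {N : ℕ} {F G : List (Fin 4) → List (Fin 3) → ℝ}
    (h : ∀ I J, I.length + J.length ≤ N → F I J ≤ G I J) : wordSum N F ≤ wordSum N G := by
  refine Finset.sum_le_sum fun i hi => Finset.sum_le_sum fun j hj => Finset.sum_le_sum fun I _ =>
    Finset.sum_le_sum fun J _ => h _ _ ?_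
  simp only [Finset.mem_range] at hi hj
  simp only [List.length_ofFn]
  omega

lemma wordSum_mul (N : ℕ) (F : List (Fin 4) → List (Fin 3) → ℝ) (c : ℝ) :
    wordSum N (fun I J => F I J * c) = wordSum N F * c := by
  simp only [wordSum, Finset.sum_mul]

lemma wordSum_sq_le (N : ℕ) {F : List (Fin 4) → List (Fin 3) → ℝ} (hF : ∀ I J, 0 ≤ F I J) :
    wordSum N (fun I J => F I J ^ 2) ≤ wordSum N F ^ 2 := by
  rw [pow_two (wordSum N F), ← wordSum_mul]
  refine wordSum_mono fun I J h => ?_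
  rw [pow_two]
  exact mul_le_mul_of_nonneg_left (le_wordSum hF h) (hF I J)

lemma density_nonneg (w : Spacetime → ℝ) (p : Spacetime) : 0 ≤ density w p := by
  unfold density
  positivity

lemma totalDensity_nonneg (N : ℕ) (u : Spacetime → ℝ) (p : Spacetime) :
    0 ≤ totalDensity N u p := wordSum_nonneg fun _ _ => density_nonneg _ _

lemma density_congr {v w : Spacetime → ℝ} (h : Set.EqOn v w cone) {p : Spacetime} (hp : p ∈ cone) :
    density v p = density w p := by
  have h1 : ∀ α, pd α v p = pd α w p := fun α => fieldD_congr h (.inl α) hp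
  simp only [density, opK, hypDs, hypD, h1, h hp]

lemma density_const_mul {w : Spacetime → ℝ} {p : Spacetime} (hw : DifferentiableAt ℝ w p) (r : ℝ) :
    density (fun q => r * w q) p = r ^ 2 * density w p := by
  have h1 : ∀ α, pd α (fun q => r * w q) p = r * pd α w p := fun α => by
    rw [← fieldD_inl, fieldD_mul (by fun_prop) hw, fieldD_const]; ring
  simp only [density, opK, hypDs, hypD, h1, Fin.sum_univ_three]
  ring

lemma density_add_le {v w : Spacetime → ℝ} {p : Spacetime} (hv : DifferentiableAt ℝ v p)
    (hw : DifferentiableAt ℝ w p) :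
    density (fun q => v q + w q) p ≤ 2 * density v p + 2 * density w p := by
  have h1 : ∀ α, pd α (fun q => v q + w q) p = pd α v p + pd α w p := fun α => by
    rw [← fieldD_inl, fieldD_add hv hw]
  have hD : ∀ a, hypD a (fun q => v q + w q) p = hypD a v p + hypD a w p := fun a => by
    simp only [hypD, h1]; ring
  have hK : opK (fun q => v q + w q) p = opK v p + opK w p := by
    simp only [opK, hypDs, hD, h1, Fin.sum_univ_three]; ring
  have key : ∀ x y : ℝ, (x + y) ^ 2 ≤ 2 * x ^ 2 + 2 * y ^ 2 := fun x y => by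
    nlinarith [sq_nonneg (x - y)]
  have h2 := fun a => key (hypTime p * hypD a v p) (hypTime p * hypD a w p)
  have h3 := key (opK v p + 2 * v p) (opK w p + 2 * w p)
  have h4 := key (hypTime p / p.1 * v p) (hypTime p / p.1 * w p)
  simp only [density, hD, hK, Fin.sum_univ_three, mul_add]
  rw [show opK v p + opK w p + (2 * v p + 2 * w p) = opK v p + 2 * v p + (opK w p + 2 * w p) by
    ring]
  linarith [h2 0, h2 1, h2 2]

/-- The densities of all words are controlled by those of the words `∂^I L^J`. -/
lemma exists_density_wordD_le {N : ℕ} (W : List FieldIndex) (hW : W.length ≤ N) :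
    ∃ C : ℝ, 0 ≤ C ∧ ∀ u, ConeSupported (N + 1) u → ∀ p ∈ cone,
      density (wordD W u) p ≤ C * totalDensity N u p := by
  have hA := isCoeffClass_isConst
  have hG := isGenClass_orderedWord (N + 1)
  have h := comb_wordD_orderedWord (R := N + 1) W (by omega)
  generalize wordD W = P at h
  induction h with
  | @gen c g hc hg =>
    obtain ⟨r, rfl⟩ := hc
    obtain ⟨I, J, hIJ⟩ := hg
    refine ⟨r ^ 2, by positivity, fun u hu p hp => ?_⟩
    have hd : ConeSupported 1 (derivWord I J u) := hu.derivWord I J (by omega)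
    rw [density_const_mul (ConeSupported.differentiable (k := 0) hd p)]
    exact mul_le_mul_of_nonneg_left (le_wordSum (fun I J => density_nonneg (derivWord I J u) p)
      (by omega)) (by positivity)
  | add h1 h2 ih1 ih2 =>
    obtain ⟨C, hC, ih1⟩ := ih1
    obtain ⟨D, hD, ih2⟩ := ih2
    refine ⟨2 * C + 2 * D, by positivity, fun u hu p hp => ?_⟩
    have := density_add_le (h1.differentiableAt hA hG (by omega) hu hp)
      (h2.differentiableAt hA hG (by omega) hu hp)
    have := ih1 u hu p hp
    have := ih2 u hu p hp
    linarith
  | congr _ h ih =>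
    obtain ⟨C, hC, ih⟩ := ih
    exact ⟨C, hC, fun u hu p hp => by rw [density_congr (h u hu) hp]; exact ih u hu p hp⟩

/-- `ρ² |P u|²` is bounded on the cone by a constant multiple of the total density of `u`, with a
constant that does not depend on `u`. -/
def DensityBound (N : ℕ) (ρ : Spacetime → ℝ) (P : Operator) : Prop :=
  ∃ C : ℝ, 0 ≤ C ∧ ∀ u, ConeSupported (N + 1) u → ∀ p ∈ cone,
    (ρ p * P u p) ^ 2 ≤ C * totalDensity N u p

lemma Comb.densityBound {R N n : ℕ} {ρ : Spacetime → ℝ} {G : ℕ → Operator → Prop} {P : Operator}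
    (hR : R = N + 1) (hG : ∀ g, G n g → DensityBound N ρ g) (h : Comb R Coeff G n P) :
    DensityBound N ρ P := by
  subst hR
  induction h with
  | @gen c g hc hg =>
    obtain ⟨C, hC, h1⟩ := hG g hg
    obtain ⟨D, hD, h2⟩ := hc.bounded
    refine ⟨D ^ 2 * C, by positivity, fun u hu p hp => ?_⟩
    have h3 : (ρ p * (c p * g u p)) ^ 2 = |c p| ^ 2 * (ρ p * g u p) ^ 2 := by
      rw [sq_abs]; ring
    rw [h3, mul_assoc]
    exact mul_le_mul (pow_le_pow_left₀ (abs_nonneg _) (h2 p hp) 2) (h1 u hu p hp) (sq_nonneg _)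
      (by positivity)
  | @add P Q _ _ ih1 ih2 =>
    obtain ⟨C, hC, ih1⟩ := ih1
    obtain ⟨D, hD, ih2⟩ := ih2
    refine ⟨2 * C + 2 * D, by positivity, fun u hu p hp => ?_⟩
    have := ih1 u hu p hp
    have := ih2 u hu p hp
    nlinarith [sq_nonneg (ρ p * P u p - ρ p * Q u p)]
  | congr _ h ih =>
    obtain ⟨C, hC, ih⟩ := ih
    exact ⟨C, hC, fun u hu p hp => by rw [h u hu hp]; exact ih u hu p hp⟩

section jet

variable {p : Spacetime} (w : Spacetime → ℝ)

lemma hypTime_le_time (hp : p ∈ cone) : hypTime p ≤ p.1 := by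
  have h1 := hypTime_sq hp
  have h2 := cone_time_pos hp
  nlinarith [hypTime_pos hp, sq_nonneg ‖p.2‖]

lemma sq_hypTime_div_mul_le : (hypTime p / p.1 * w p) ^ 2 ≤ density w p := by
  have : 0 ≤ ∑ a : Fin 3, (hypTime p * hypD a w p) ^ 2 := by positivity
  unfold density
  nlinarith [sq_nonneg (opK w p + 2 * w p)]

lemma sq_hypTime_mul_hypD_le (a : Fin 3) : (hypTime p * hypD a w p) ^ 2 ≤ density w p := by
  have := Finset.single_le_sum (f := fun a => (hypTime p * hypD a w p) ^ 2)
    (fun _ _ => sq_nonneg _) (Finset.mem_univ a)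
  unfold density
  nlinarith [sq_nonneg (opK w p + 2 * w p), sq_nonneg (hypTime p / p.1 * w p)]

lemma sq_opK_le : (opK w p + 2 * w p) ^ 2 ≤ density w p := by
  have : 0 ≤ ∑ a : Fin 3, (hypTime p * hypD a w p) ^ 2 := by positivity
  unfold density
  nlinarith [sq_nonneg (hypTime p / p.1 * w p)]

/-- `(s³/t²) ∂_t w = (s/t) (K w + 2 w) - 2 ∑_a (x^a/t) s ∂̲_a w - 2 (s/t) w`, and
`∂_a = ∂̲_a - (x^a/t) ∂_t`. -/
lemma sq_mul_pd_le (hp : p ∈ cone) (α : Fin 4) :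
    (hypTime p ^ 2 / p.1 * (hypTime p / p.1 * pd α w p)) ^ 2 ≤ 100 * density w p := by
  have ht := cone_time_pos hp
  have hs := hypTime_pos hp
  have hst := hypTime_le_time hp
  have hx : ∀ a, |p.2 a / p.1| ≤ 1 := fun a => by
    have h2 : ‖p.2‖ + 1 < p.1 := hp
    rw [abs_div, abs_of_pos (by linarith : 0 < p.1), div_le_one (by linarith)]
    linarith [abs_coord_le p.2 a]
  have hst' : |hypTime p / p.1| ≤ 1 := by
    rw [abs_div, abs_of_pos hs, abs_of_pos (by linarith : 0 < p.1), div_le_one (by linarith)]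
    exact hst
  set e := √(density w p) with he
  have he0 : 0 ≤ e := Real.sqrt_nonneg _
  have hmul : ∀ {x y : ℝ}, |x| ≤ 1 → |y| ≤ e → |x * y| ≤ e := fun {x y} h1 h2 => by
    rw [abs_mul]
    nlinarith [abs_nonneg x, abs_nonneg y]
  have hD : ∀ a, |hypTime p * hypD a w p| ≤ e := fun a =>
    Real.abs_le_sqrt (sq_hypTime_mul_hypD_le w a)
  have hw : |hypTime p / p.1 * w p| ≤ e := Real.abs_le_sqrt (sq_hypTime_div_mul_le w)
  have hK : |opK w p + 2 * w p| ≤ e := Real.abs_le_sqrt (sq_opK_le w)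
  have h0 : |hypTime p ^ 2 / p.1 * (hypTime p / p.1 * pd 0 w p)| ≤ 9 * e := by
    have h1 := abs_le.1 (hmul hst' hK)
    have h2 := fun a => abs_le.1 (hmul (hx a) (hD a))
    have h3 := abs_le.1 hw
    have : hypTime p ^ 2 / p.1 * (hypTime p / p.1 * pd 0 w p)
        = hypTime p / p.1 * (opK w p + 2 * w p) - 2 * ∑ a, p.2 a / p.1 * (hypTime p * hypD a w p)
          - 2 * (hypTime p / p.1 * w p) := by
      simp only [opK, hypDs, Fin.sum_univ_three]
      ring
    rw [this, Fin.sum_univ_three, abs_le]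
    constructor <;> linarith [h2 0, h2 1, h2 2, h1.1, h1.2, h3.1, h3.2, (h2 0).1, (h2 1).1,
      (h2 2).1, (h2 0).2, (h2 1).2, (h2 2).2]
  have hα : |hypTime p ^ 2 / p.1 * (hypTime p / p.1 * pd α w p)| ≤ 10 * e := by
    refine Fin.cases (by linarith) (fun a => ?_) α
    have h1 := hmul hst' (hmul hst' (hD a))
    have h2 : hypTime p ^ 2 / p.1 * (hypTime p / p.1 * pd a.succ w p)
        = hypTime p / p.1 * (hypTime p / p.1 * (hypTime p * hypD a w p))
          - p.2 a / p.1 * (hypTime p ^ 2 / p.1 * (hypTime p / p.1 * pd 0 w p)) := by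
      simp only [hypD]
      ring
    have h3 : |p.2 a / p.1 * (hypTime p ^ 2 / p.1 * (hypTime p / p.1 * pd 0 w p))| ≤ 9 * e := by
      rw [abs_mul]
      exact (mul_le_of_le_one_left (abs_nonneg _) (hx a)).trans h0
    rw [h2]
    exact (abs_sub _ _).trans (by linarith)
  calc _ ≤ (10 * e) ^ 2 := sq_le_sq.2 (hα.trans (le_abs_self _))
    _ = 100 * density w p := by
      rw [mul_pow, Real.sq_sqrt (density_nonneg w p)]; norm_num

end jet

lemma densityBound_of_wordD {N : ℕ} {ρ : Spacetime → ℝ} {P : Operator} (c : ℝ) (hc : 0 ≤ c)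
    (W : List FieldIndex) (hW : W.length ≤ N)
    (h : ∀ u, ∀ p ∈ cone, (ρ p * P u p) ^ 2 ≤ c * density (wordD W u) p) :
    DensityBound N ρ P := by
  obtain ⟨C, hC, h1⟩ := exists_density_wordD_le W hW
  refine ⟨c * C, by positivity, fun u hu p hp => ?_⟩
  rw [mul_assoc]
  exact (h u p hp).trans (mul_le_mul_of_nonneg_left (h1 u hu p hp) hc)

variable {N n : ℕ} {P : Operator}

lemma densityBound_word (hn : n ≤ N) (h : Comb (N + 1) Coeff WordClass n P) :
    DensityBound N (fun p => hypTime p / p.1) P := by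
  refine h.densityBound rfl ?_
  rintro _ ⟨W, hW⟩
  exact densityBound_of_wordD 1 zero_le_one W (by omega) fun u p _ => by
    rw [one_mul]; exact sq_hypTime_div_mul_le _

lemma densityBound_tangential (hn : n ≤ N) (h : Comb (N + 1) Coeff TangentialClass n P) :
    DensityBound N hypTime P := by
  refine h.densityBound rfl ?_
  rintro _ (⟨a, W, hW⟩ | ⟨W, hW⟩)
  · exact densityBound_of_wordD 1 zero_le_one W (by omega) fun u p _ => by
      rw [one_mul]; exact sq_hypTime_mul_hypD_le _ a
  · exact densityBound_of_wordD 1 zero_le_one W (by omega) fun u p _ => by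
      rw [one_mul, ← mul_assoc, ← div_eq_mul_inv]; exact sq_hypTime_div_mul_le _

lemma densityBound_transversal (hn : n ≤ N) (h : Comb (N + 1) Coeff TransversalClass n P) :
    DensityBound N (fun p => hypTime p ^ 2 / p.1) P := by
  refine h.densityBound rfl ?_
  rintro _ (⟨α, W, hW⟩ | ⟨W, hW⟩)
  · exact densityBound_of_wordD 100 (by norm_num) W (by omega) fun u p hp => sq_mul_pd_le _ hp α
  · refine densityBound_of_wordD 1 zero_le_one W (by omega) fun u p hp => ?_
    have h1 := hypTime_pos hp
    have h2 := cone_time_pos hp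
    have : hypTime p ^ 2 / p.1 * ((hypTime p)⁻¹ * wordD W u p)
        = hypTime p / p.1 * wordD W u p := by field_simp
    rw [this, one_mul]
    exact sq_hypTime_div_mul_le _

/-! ### A Sobolev inequality on balls of three-space -/

section sobolev

open MeasureTheory Set

lemma sq_integral_le (g : ℝ → ℝ) (hg : Continuous g) :
    (∫ r in (0 : ℝ)..1, g r) ^ 2 ≤ ∫ r in (0 : ℝ)..1, g r ^ 2 := by
  set m := ∫ r in (0 : ℝ)..1, g r with hm
  have h0 : 0 ≤ ∫ r in (0 : ℝ)..1, (g r - m) ^ 2 :=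
    intervalIntegral.integral_nonneg zero_le_one fun r _ => sq_nonneg _
  have h1 : ∫ r in (0 : ℝ)..1, (g r - m) ^ 2
      = (∫ r in (0 : ℝ)..1, g r ^ 2) - 2 * m * m + m ^ 2 := by
    have : ∀ r, (g r - m) ^ 2 = (g r ^ 2 - 2 * m * g r) + m ^ 2 := fun r => by ring
    simp only [this]
    rw [intervalIntegral.integral_add, intervalIntegral.integral_sub,
      intervalIntegral.integral_const_mul, ← hm]
    · simp
    all_goals exact Continuous.intervalIntegrable (by fun_prop) _ _
  rw [h1] at h0
  nlinarith

/-- Integrating `r ((1 - r)² φ(r))''` by parts twice gives `φ(0)`: this is the fundamental solution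
of the Laplacian in three dimensions in disguise, since `r dr = |y|⁻¹ r² dr`. The factor `(1 - r)²`
removes the boundary terms at `r = 1`. -/
lemma eval_zero_eq_integral {φ φ' φ'' : ℝ → ℝ} (h1 : ∀ r, HasDerivAt φ (φ' r) r)
    (h2 : ∀ r, HasDerivAt φ' (φ'' r) r) (h3 : Continuous φ'') :
    φ 0 = ∫ r in (0 : ℝ)..1, r * (2 * φ r - 4 * (1 - r) * φ' r + (1 - r) ^ 2 * φ'' r) := by
  have c1 : Continuous φ := continuous_iff_continuousAt.2 fun r => (h1 r).continuousAt
  have c2 : Continuous φ' := continuous_iff_continuousAt.2 fun r => (h2 r).continuousAt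
  have key : ∀ r, HasDerivAt
      (fun r => r * (-2 * (1 - r) * φ r + (1 - r) ^ 2 * φ' r) - (1 - r) ^ 2 * φ r)
      (r * (2 * φ r - 4 * (1 - r) * φ' r + (1 - r) ^ 2 * φ'' r)) r := fun r => by
    have e0 : HasDerivAt (fun r : ℝ => 1 - r) (-1) r := by
      simpa using (hasDerivAt_id r).const_sub 1
    have e1 := (e0.fun_pow 2)
    refine (((hasDerivAt_id' r).fun_mul (((e0.const_mul (-2)).fun_mul (h1 r)).fun_add
      (e1.fun_mul (h2 r)))).fun_sub (e1.fun_mul (h1 r))).congr_deriv ?_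
    simp only [Nat.cast_ofNat, Nat.add_one_sub_one, pow_one]
    ring
  rw [intervalIntegral.integral_eq_sub_of_hasDerivAt (fun r _ => key r)
    (Continuous.intervalIntegrable (by fun_prop) _ _)]
  simp

lemma sq_eval_zero_le {φ φ' φ'' G : ℝ → ℝ} (h1 : ∀ r, HasDerivAt φ (φ' r) r)
    (h2 : ∀ r, HasDerivAt φ' (φ'' r) r) (h3 : Continuous φ'') (hG : Continuous G)
    (b0 : ∀ r ∈ Ioo (0 : ℝ) 1, φ r ^ 2 ≤ G r) (b1 : ∀ r ∈ Ioo (0 : ℝ) 1, φ' r ^ 2 ≤ G r)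
    (b2 : ∀ r ∈ Ioo (0 : ℝ) 1, φ'' r ^ 2 ≤ G r) :
    φ 0 ^ 2 ≤ 49 * ∫ r in (0 : ℝ)..1, r ^ 2 * G r := by
  have c1 : Continuous φ := continuous_iff_continuousAt.2 fun r => (h1 r).continuousAt
  have c2 : Continuous φ' := continuous_iff_continuousAt.2 fun r => (h2 r).continuousAt
  rw [eval_zero_eq_integral h1 h2 h3, ← intervalIntegral.integral_const_mul]
  refine (sq_integral_le _ (by fun_prop)).trans (intervalIntegral.integral_mono_on_of_le_Ioo
    zero_le_one (Continuous.intervalIntegrable (by fun_prop) _ _)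
    (Continuous.intervalIntegrable (by fun_prop) _ _) fun r hr => ?_)
  have hG0 : 0 ≤ G r := (sq_nonneg _).trans (b0 r hr)
  have a0 := abs_le.1 (Real.abs_le_sqrt (b0 r hr))
  have a1 := Real.abs_le_sqrt (b1 r hr)
  have a2 := Real.abs_le_sqrt (b2 r hr)
  have hr1 : |1 - r| ≤ 1 := abs_le.2 ⟨by linarith [hr.2], by linarith [hr.1]⟩
  -- the three terms are at most `2`, `4` and `1` times `√(G r)`, and `(2 + 4 + 1)² = 49`
  have a1' : |(1 - r) * φ' r| ≤ √(G r) := by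
    rw [abs_mul]
    exact (mul_le_of_le_one_left (abs_nonneg _) hr1).trans a1
  have a2' : |(1 - r) ^ 2 * φ'' r| ≤ √(G r) := by
    rw [abs_mul, abs_pow]
    exact (mul_le_of_le_one_left (abs_nonneg _) (pow_le_one₀ (abs_nonneg _) hr1)).trans a2
  have b : |2 * φ r - 4 * (1 - r) * φ' r + (1 - r) ^ 2 * φ'' r| ≤ 7 * √(G r) := by
    have := abs_le.1 a1'
    have := abs_le.1 a2'
    rw [abs_le]
    constructor <;> linarith
  have b' : (2 * φ r - 4 * (1 - r) * φ' r + (1 - r) ^ 2 * φ'' r) ^ 2 ≤ 49 * G r := by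
    calc _ ≤ (7 * √(G r)) ^ 2 := sq_le_sq.2 (b.trans (le_abs_self _))
      _ = 49 * G r := by rw [mul_pow, Real.sq_sqrt hG0]; norm_num
  nlinarith [sq_nonneg r]

/-- Integration in polar coordinates. -/
lemma lintegral_polar {g : EuclideanSpace ℝ (Fin 3) → ENNReal} (hg : Measurable g) :
    ∫⁻ y, g y = ∫⁻ v : Metric.sphere (0 : EuclideanSpace ℝ (Fin 3)) 1,
      (∫⁻ r in Ioi (0 : ℝ), ENNReal.ofReal (r ^ 2) * g (r • v.1))
        ∂(volume : Measure (EuclideanSpace ℝ (Fin 3))).toSphere := by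
  have hd : Module.finrank ℝ (EuclideanSpace ℝ (Fin 3)) - 1 = 2 := by simp
  have mp := (volume : Measure (EuclideanSpace ℝ (Fin 3))).measurePreserving_homeomorphUnitSphereProd
  have h1 : ∫⁻ y, g y = ∫⁻ y in ({0}ᶜ : Set (EuclideanSpace ℝ (Fin 3))), g y := by
    rw [restrict_compl_singleton]
  rw [hd] at mp
  have hm : Measurable fun b : Metric.sphere (0 : EuclideanSpace ℝ (Fin 3)) 1 × Ioi (0 : ℝ) =>
      g (b.2.1 • b.1.1) := hg.comp (by fun_prop)
  have h2 := mp.lintegral_comp hm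
  rw [h1, ← lintegral_subtype_comap (measurableSet_singleton _).compl g]
  have h3 : ∀ y : ({0}ᶜ : Set (EuclideanSpace ℝ (Fin 3))),
      g ((homeomorphUnitSphereProd _ y).2.1 • (homeomorphUnitSphereProd _ y).1.1) = g y := fun y => by
    have : ‖y.1‖ ≠ 0 := norm_ne_zero_iff.2 y.2
    simp [smul_smul, this]
  simp only [h3] at h2
  rw [h2, lintegral_prod _ hm.aemeasurable]
  refine lintegral_congr fun v => ?_
  rw [Measure.volumeIoiPow, lintegral_withDensity_eq_lintegral_mul _ (by fun_prop) (by fun_prop)]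
  exact lintegral_subtype_comap measurableSet_Ioi
    fun r => ENNReal.ofReal (r ^ 2) * g (r • v.1)

/-- A scaled Sobolev inequality: the value at the centre of a ball of radius `R` is controlled by
the square integrals of the derivatives of order at most two, each with its power of `R`. -/
theorem exists_sobolev_ball : ∃ C : ℝ, 0 ≤ C ∧
    ∀ (f G : EuclideanSpace ℝ (Fin 3) → ℝ) (x₀ : EuclideanSpace ℝ (Fin 3)) (R : ℝ), 0 < R →
      ContDiff ℝ 2 f → Continuous G → Integrable G → (∀ x, 0 ≤ G x) →
      (∀ x ∈ Metric.ball x₀ R, f x ^ 2 ≤ G x) →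
      (∀ x ∈ Metric.ball x₀ R, ∀ v, ‖v‖ = 1 → (R * fderiv ℝ f x v) ^ 2 ≤ G x) →
      (∀ x ∈ Metric.ball x₀ R, ∀ v, ‖v‖ = 1 →
        (R ^ 2 * fderiv ℝ (fderiv ℝ f) x v v) ^ 2 ≤ G x) →
      R ^ 3 * f x₀ ^ 2 ≤ C * ∫ x, G x := by
  set σ := (volume : Measure (EuclideanSpace ℝ (Fin 3))).toSphere with hσ
  have hσ0 : 0 < σ.real univ := by
    have : σ univ ≠ 0 := by
      rw [Ne, Measure.measure_univ_eq_zero]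
      exact Measure.toSphere_ne_zero _
    exact ENNReal.toReal_pos this (measure_ne_top _ _)
  refine ⟨49 * (σ.real univ)⁻¹, by positivity, fun f G x₀ R hR hf hG hGi hG0 b0 b1 b2 => ?_⟩
  have hf1 : Differentiable ℝ f := hf.differentiable (by norm_num)
  have hf' : ContDiff ℝ 1 (fderiv ℝ f) := hf.fderiv_right (by norm_num)
  have hf2 : Differentiable ℝ (fderiv ℝ f) := hf'.differentiable (by norm_num)
  have hf3 : Continuous (fderiv ℝ (fderiv ℝ f)) := hf'.continuous_fderiv (by norm_num)
  -- the inequality along a single ray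
  have ray : ∀ v : EuclideanSpace ℝ (Fin 3), ‖v‖ = 1 →
      ENNReal.ofReal (f x₀ ^ 2) ≤ ∫⁻ r in Ioi (0 : ℝ),
        ENNReal.ofReal (r ^ 2) * ENNReal.ofReal (49 * G (x₀ + R • r • v)) := fun v hv => by
    have hline : ∀ r : ℝ, HasDerivAt (fun r : ℝ => x₀ + R • r • v) (R • v) r := fun r => by
      simpa using (((hasDerivAt_id r).smul_const v).const_smul R).const_add x₀
    have hball : ∀ r ∈ Ioo (0 : ℝ) 1, x₀ + R • r • v ∈ Metric.ball x₀ R := fun r hr => by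
      rw [mem_ball_iff_norm, add_sub_cancel_left, norm_smul, norm_smul, hv, Real.norm_eq_abs,
        Real.norm_eq_abs, abs_of_pos hR, abs_of_pos hr.1]
      nlinarith [hr.2]
    have key := sq_eval_zero_le (φ := fun r => f (x₀ + R • r • v))
      (φ' := fun r => R * fderiv ℝ f (x₀ + R • r • v) v)
      (φ'' := fun r => R ^ 2 * fderiv ℝ (fderiv ℝ f) (x₀ + R • r • v) v v)
      (G := fun r => G (x₀ + R • r • v))
      (fun r => ((hf1 (x₀ + R • r • v)).hasFDerivAt.comp_hasDerivAt r (hline r)).congr_deriv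
        (by simp))
      (fun r => by
        have h := (hf2 (x₀ + R • r • v)).hasFDerivAt.comp_hasDerivAt r (hline r)
        have h' := (h.clm_apply (hasDerivAt_const r v)).const_mul R
        refine h'.congr_deriv ?_
        simp
        ring)
      (by fun_prop) (by fun_prop) (fun r hr => b0 _ (hball r hr))
      (fun r hr => b1 _ (hball r hr) v hv) (fun r hr => b2 _ (hball r hr) v hv)
    simp only [zero_smul, smul_zero, add_zero] at key
    calc ENNReal.ofReal (f x₀ ^ 2)
        ≤ ENNReal.ofReal (∫ r in Ioc (0 : ℝ) 1, r ^ 2 * (49 * G (x₀ + R • r • v))) := by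
          refine ENNReal.ofReal_le_ofReal (key.trans_eq ?_)
          rw [← intervalIntegral.integral_const_mul, intervalIntegral.integral_of_le zero_le_one]
          refine integral_congr_ae (.of_forall fun r => ?_)
          simp only
          ring
      _ = ∫⁻ r in Ioc (0 : ℝ) 1, ENNReal.ofReal (r ^ 2 * (49 * G (x₀ + R • r • v))) := by
          refine ofReal_integral_eq_lintegral_ofReal ?_ (.of_forall fun r => ?_)
          · rw [← IntegrableOn, ← intervalIntegrable_iff_integrableOn_Ioc_of_le zero_le_one]
            exact Continuous.intervalIntegrable (by fun_prop) _ _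
          · have := hG0 (x₀ + R • r • v)
            simp only [Pi.zero_apply]
            positivity
      _ ≤ _ := by
          simp only [ENNReal.ofReal_mul (sq_nonneg _)]
          exact lintegral_mono_set Ioc_subset_Ioi_self
  have hint : Integrable fun y => 49 * G (x₀ + R • y) :=
    (Integrable.comp_smul (f := fun y => G (x₀ + y)) (hGi.comp_add_left x₀) hR.ne').const_mul 49
  have hpol := lintegral_polar (g := fun y => ENNReal.ofReal (49 * G (x₀ + R • y)))
    (by fun_prop)
  have hle : ENNReal.ofReal (f x₀ ^ 2) * σ univ
      ≤ ENNReal.ofReal (∫ y, 49 * G (x₀ + R • y)) := by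
    rw [ofReal_integral_eq_lintegral_ofReal hint (.of_forall fun y => by
      have := hG0 (x₀ + R • y); simp only [Pi.zero_apply]; positivity), hpol, ← lintegral_const]
    exact lintegral_mono fun v => ray v.1 (by simp)
  have hscale : ∫ y, 49 * G (x₀ + R • y) = 49 * ((R ^ 3)⁻¹ * ∫ x, G x) := by
    rw [integral_const_mul, Measure.integral_comp_smul volume (fun y => G (x₀ + y)) R,
      integral_add_left_eq_self (fun y => G y) x₀]
    simp [abs_of_pos hR]
  rw [hscale, ← ofReal_measureReal, ← ENNReal.ofReal_mul (sq_nonneg _)] at hle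
  have hI : 0 ≤ ∫ x, G x := integral_nonneg hG0
  have := (ENNReal.ofReal_le_ofReal_iff (by positivity)).1 hle
  have hR3 : 0 < R ^ 3 := by positivity
  rw [mul_assoc, mul_comm (σ.real univ)⁻¹, ← mul_assoc, ← div_eq_mul_inv, le_div_iff₀ hσ0]
  calc R ^ 3 * f x₀ ^ 2 * σ.real univ = R ^ 3 * (f x₀ ^ 2 * σ.real univ) := by ring
    _ ≤ R ^ 3 * (49 * ((R ^ 3)⁻¹ * ∫ x, G x)) := by gcongr
    _ = 49 * ∫ x, G x := by field_simp

end sobolev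

/-! ### Hardy's inequality -/

section hardy

open MeasureTheory

lemma integral_fderiv_apply_eq_zero {g : EuclideanSpace ℝ (Fin 3) → ℝ} (hg : ContDiff ℝ 1 g)
    (hs : HasCompactSupport g) (v : EuclideanSpace ℝ (Fin 3)) : ∫ x, fderiv ℝ g x v = 0 := by
  have h1 : Continuous fun x => fderiv ℝ g x v := (hg.continuous_fderiv (by simp)).clm_apply
    continuous_const
  have h2 : Integrable fun x => fderiv ℝ g x v :=
    h1.integrable_of_hasCompactSupport (hs.fderiv_apply ℝ v)
  have := integral_mul_fderiv_eq_neg_fderiv_mul_of_integrable (μ := volume) (v := v)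
    (f := fun _ : EuclideanSpace ℝ (Fin 3) => (1 : ℝ)) (g := g) (by simp) (by simpa using h2)
    (by simpa using hg.continuous.integrable_of_hasCompactSupport hs)
    (fun x _ => differentiableAt_const _) (fun x _ => hg.differentiable (by simp) x)
  simpa using this

/-- Hardy's inequality with the weight `1/(s² + |x|²)`: the divergence of `x/(s² + |x|²)` is at
least `1/(s² + |x|²)`. -/
theorem hardy {f : EuclideanSpace ℝ (Fin 3) → ℝ} (hf : ContDiff ℝ 1 f) (hs : HasCompactSupport f)
    {s : ℝ} (hs0 : 0 < s) :
    ∫ x, f x ^ 2 / (s ^ 2 + ‖x‖ ^ 2)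
      ≤ 4 * ∫ x, ∑ a : Fin 3, fderiv ℝ f x (EuclideanSpace.single a 1) ^ 2 := by
  set T : EuclideanSpace ℝ (Fin 3) → ℝ := fun x => s ^ 2 + ‖x‖ ^ 2 with hT
  have hT0 : ∀ x, 0 < T x := fun x => by simp only [hT]; positivity
  have hTc : ContDiff ℝ 1 T := contDiff_const.add (contDiff_id.norm_sq ℝ)
  have hX : ∀ a : Fin 3, ContDiff ℝ 1 fun x : EuclideanSpace ℝ (Fin 3) => x a * (T x)⁻¹ := fun a =>
    ContDiff.mul (by fun_prop) (hTc.inv fun x => (hT0 x).ne')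
  set g : Fin 3 → EuclideanSpace ℝ (Fin 3) → ℝ := fun a x => f x * f x * (x a * (T x)⁻¹) with hg
  have hgc : ∀ a, ContDiff ℝ 1 (g a) := fun a => (hf.mul hf).mul (hX a)
  have hgs : ∀ a, HasCompactSupport (g a) := fun a => (hs.mul_right (f' := f)).mul_right
  have hder : ∀ a x, fderiv ℝ (g a) x (EuclideanSpace.single a 1)
      = 2 * f x * fderiv ℝ f x (EuclideanSpace.single a 1) * x a / T x
        + f x ^ 2 * (1 / T x - 2 * x a ^ 2 / T x ^ 2) := fun a x => by
    have d1 : HasFDerivAt f (fderiv ℝ f x) x := (hf.differentiable (by simp) x).hasFDerivAt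
    have d2 : HasFDerivAt (fun x : EuclideanSpace ℝ (Fin 3) => x a)
      (EuclideanSpace.proj a : EuclideanSpace ℝ (Fin 3) →L[ℝ] ℝ) x :=
      (EuclideanSpace.proj a : EuclideanSpace ℝ (Fin 3) →L[ℝ] ℝ).hasFDerivAt
    have d3 : HasFDerivAt T (2 • innerSL ℝ x) x :=
      (hasStrictFDerivAt_norm_sq x).hasFDerivAt.const_add (s ^ 2)
    have d4 := (hasDerivAt_inv (hT0 x).ne').comp_hasFDerivAt x d3
    have d5 := (d1.mul d1).mul (d2.mul d4)
    have : g a = (f * f) * ((fun x : EuclideanSpace ℝ (Fin 3) => x a) * (Inv.inv ∘ T)) := rfl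
    rw [this, d5.fderiv]
    have := (hT0 x).ne'
    simp [EuclideanSpace.inner_single_right]
    field_simp
    ring
  have hfc := hf.continuous
  have hDc : ∀ a : Fin 3, Continuous fun x => fderiv ℝ f x (EuclideanSpace.single a 1) := fun a =>
    (hf.continuous_fderiv (by simp)).clm_apply continuous_const
  have i1 : Integrable fun x => f x ^ 2 / T x :=
    Continuous.integrable_of_hasCompactSupport
      ((hfc.pow 2).div hTc.continuous fun x => (hT0 x).ne')
      (hs.mono fun x hx => by
        contrapose! hx
        simp only [Function.mem_support, ne_eq, not_not] at hx ⊢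
        simp [hx])
  have i2 : Integrable fun x => ∑ a : Fin 3, fderiv ℝ f x (EuclideanSpace.single a 1) ^ 2 :=
    integrable_finsetSum _ fun a _ => Continuous.integrable_of_hasCompactSupport
      ((hDc a).pow 2) ((hs.fderiv_apply ℝ (EuclideanSpace.single a 1)).mono fun x hx => by
        contrapose! hx
        simp only [Function.mem_support, ne_eq, not_not] at hx ⊢
        simp [hx])
  have i3 : ∀ a, Integrable fun x => fderiv ℝ (g a) x (EuclideanSpace.single a 1) := fun a =>
    Continuous.integrable_of_hasCompactSupport
      (((hgc a).continuous_fderiv (by simp)).clm_apply continuous_const)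
      ((hgs a).fderiv_apply ℝ _)
  have hzero : ∫ x, ∑ a, fderiv ℝ (g a) x (EuclideanSpace.single a 1) = 0 := by
    rw [integral_finsetSum _ fun a _ => i3 a]
    exact Finset.sum_eq_zero fun a _ => integral_fderiv_apply_eq_zero (hgc a) (hgs a) _
  have hpt : ∀ x, f x ^ 2 / T x / 2
      - 2 * ∑ a : Fin 3, fderiv ℝ f x (EuclideanSpace.single a 1) ^ 2
      ≤ ∑ a, fderiv ℝ (g a) x (EuclideanSpace.single a 1) := fun x => by
    simp only [hder, Fin.sum_univ_three]
    set D := fun a : Fin 3 => fderiv ℝ f x (EuclideanSpace.single a 1)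
    have hx : x 0 ^ 2 + x 1 ^ 2 + x 2 ^ 2 ≤ T x := by
      have := norm_sq_eq_sum x
      rw [Fin.sum_univ_three] at this
      simp only [hT, this]
      nlinarith
    have h1 : (x 0 ^ 2 + x 1 ^ 2 + x 2 ^ 2) / T x ^ 2 ≤ 1 / T x := by
      rw [div_le_div_iff₀ (by have := hT0 x; positivity) (hT0 x)]
      nlinarith [hT0 x]
    have h2 := mul_le_mul_of_nonneg_left h1 (sq_nonneg (f x))
    have h3 : 0 ≤ 2 * (D 0 + f x * x 0 / (2 * T x)) ^ 2 + 2 * (D 1 + f x * x 1 / (2 * T x)) ^ 2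
        + 2 * (D 2 + f x * x 2 / (2 * T x)) ^ 2 := by positivity
    have h4 : 2 * (D 0 + f x * x 0 / (2 * T x)) ^ 2 + 2 * (D 1 + f x * x 1 / (2 * T x)) ^ 2
        + 2 * (D 2 + f x * x 2 / (2 * T x)) ^ 2
        = 2 * (D 0 ^ 2 + D 1 ^ 2 + D 2 ^ 2)
          + (2 * f x * D 0 * x 0 / T x + 2 * f x * D 1 * x 1 / T x + 2 * f x * D 2 * x 2 / T x)
          + f x ^ 2 * ((x 0 ^ 2 + x 1 ^ 2 + x 2 ^ 2) / T x ^ 2) / 2 := by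
      have := (hT0 x).ne'
      field_simp
      ring
    have h5 : f x ^ 2 * (1 / T x) = f x ^ 2 / T x := by ring
    have h6 : f x ^ 2 * (1 / T x - 2 * x 0 ^ 2 / T x ^ 2)
        + f x ^ 2 * (1 / T x - 2 * x 1 ^ 2 / T x ^ 2) + f x ^ 2 * (1 / T x - 2 * x 2 ^ 2 / T x ^ 2)
        = 3 * (f x ^ 2 * (1 / T x))
          - 2 * (f x ^ 2 * ((x 0 ^ 2 + x 1 ^ 2 + x 2 ^ 2) / T x ^ 2)) := by
      ring
    rw [h4] at h3
    change f x ^ 2 / T x / 2 - 2 * (D 0 ^ 2 + D 1 ^ 2 + D 2 ^ 2)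
      ≤ 2 * f x * D 0 * x 0 / T x + f x ^ 2 * (1 / T x - 2 * x 0 ^ 2 / T x ^ 2)
        + (2 * f x * D 1 * x 1 / T x + f x ^ 2 * (1 / T x - 2 * x 1 ^ 2 / T x ^ 2))
        + (2 * f x * D 2 * x 2 / T x + f x ^ 2 * (1 / T x - 2 * x 2 ^ 2 / T x ^ 2))
    linarith
  have hmono := integral_mono ((i1.div_const 2).sub (i2.const_mul 2))
    (integrable_finsetSum _ fun a _ => i3 a) hpt
  have hsplit : ∫ x, (f x ^ 2 / T x / 2
      - 2 * ∑ a : Fin 3, fderiv ℝ f x (EuclideanSpace.single a 1) ^ 2)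
      = (∫ x, f x ^ 2 / T x) / 2
        - 2 * ∫ x, ∑ a : Fin 3, fderiv ℝ f x (EuclideanSpace.single a 1) ^ 2 := by
    rw [integral_sub (i1.div_const 2) (i2.const_mul 2), integral_div, integral_const_mul]
  have hmono' := hsplit.symm.trans_le (hmono.trans_eq hzero)
  linarith

end hardy

/-! ### Restriction to hyperboloids -/

section restriction

open MeasureTheory

variable {s : ℝ}

lemma hypPoint_time_pos (hs : 0 < s) (x : EuclideanSpace ℝ (Fin 3)) : 0 < (hypPoint s x).1 :=
  Real.sqrt_pos.2 (by positivity)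

lemma hypPoint_time_sq (x : EuclideanSpace ℝ (Fin 3)) :
    (hypPoint s x).1 ^ 2 = s ^ 2 + ‖x‖ ^ 2 :=
  Real.sq_sqrt (by positivity)

lemma hypTime_hypPoint (hs : 0 < s) (x : EuclideanSpace ℝ (Fin 3)) :
    hypTime (hypPoint s x) = s := by
  rw [hypTime, hypPoint_time_sq]
  simp [hypPoint, Real.sqrt_sq hs.le]

lemma eq_hypPoint {p : Spacetime} (hp : p ∈ hyperboloid s) : p = hypPoint s p.2 :=
  Prod.ext hp rfl

lemma hypPoint_time_le (x y : EuclideanSpace ℝ (Fin 3)) :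
    (hypPoint s y).1 ≤ (hypPoint s x).1 + ‖y - x‖ := by
  have h0 : 0 ≤ (hypPoint s x).1 := Real.sqrt_nonneg _
  have h1 : ‖x‖ ≤ (hypPoint s x).1 := Real.le_sqrt_of_sq_le (by nlinarith [sq_nonneg s])
  have h2 : ‖y‖ ≤ ‖x‖ + ‖y - x‖ := by
    simpa using norm_add_le x (y - x)
  refine Real.sqrt_le_iff.2 ⟨by positivity, ?_⟩
  rw [add_sq, hypPoint_time_sq]
  nlinarith [norm_nonneg x, norm_nonneg y, norm_nonneg (y - x)]

lemma contDiff_hypPoint (hs : 0 < s) : ContDiff ℝ ∞ (hypPoint s) :=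
  ((contDiff_const.add (contDiff_id.norm_sq ℝ)).sqrt fun x => by
    have : 0 < s ^ 2 + ‖x‖ ^ 2 := by positivity
    exact this.ne').prodMk contDiff_id

lemma ConeSupported.contDiff_comp {k : ℕ} {w : Spacetime → ℝ} (hw : ConeSupported k w)
    (hs : 0 < s) : ContDiff ℝ k fun x => w (hypPoint s x) :=
  hw.contDiff.comp ((contDiff_hypPoint hs).of_le (by exact_mod_cast le_top))

/-- On `ℋ_s`, in the coordinate `x`, the field `∂̲_a` is the partial derivative. -/
lemma fderiv_comp_hypPoint (hs : 0 < s) {w : Spacetime → ℝ} (hw : Differentiable ℝ w)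
    (x : EuclideanSpace ℝ (Fin 3)) (a : Fin 3) :
    fderiv ℝ (fun y => w (hypPoint s y)) x (EuclideanSpace.single a 1)
      = hypD a w (hypPoint s x) := by
  have h0 : s ^ 2 + ‖x‖ ^ 2 ≠ 0 := by positivity
  have h1 : HasFDerivAt (fun y : EuclideanSpace ℝ (Fin 3) => s ^ 2 + ‖y‖ ^ 2)
      (2 • innerSL ℝ x) x := (hasStrictFDerivAt_norm_sq x).hasFDerivAt.const_add (s ^ 2)
  have h2 : HasFDerivAt (hypPoint s) _ x := (h1.sqrt h0).prodMk (hasFDerivAt_id x)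
  have h3 := (hw (hypPoint s x)).hasFDerivAt.comp x h2
  have h4 : (fun y => w (hypPoint s y)) = w ∘ hypPoint s := rfl
  rw [h4, h3.fderiv]
  have h5 : (((1 / (2 * √(s ^ 2 + ‖x‖ ^ 2))) • (2 • innerSL ℝ x)).prod
      (ContinuousLinearMap.id ℝ (EuclideanSpace ℝ (Fin 3)))) (EuclideanSpace.single a 1)
      = (x a / (hypPoint s x).1) • frameVec 0 + frameVec a.succ := by
    have := (hypPoint_time_pos hs x).ne'
    refine Prod.ext ?_ ?_
    · simp [frameVec_zero, frameVec_succ, hypPoint, EuclideanSpace.inner_single_right]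
      field_simp
    · simp [frameVec_zero, frameVec_succ]
  rw [ContinuousLinearMap.comp_apply, h5]
  simp [hypD, pd, hypPoint]

/-- A function on `ℋ_s` that vanishes outside of the cone has compact support. -/
lemma hasCompactSupport_of_cone {g : EuclideanSpace ℝ (Fin 3) → ℝ}
    (hg : ∀ x, hypPoint s x ∉ cone → g x = 0) : HasCompactSupport g := by
  refine HasCompactSupport.of_support_subset_isCompact
    (isCompact_closedBall (0 : EuclideanSpace ℝ (Fin 3)) (s ^ 2)) fun x hx => ?_
  have h1 : hypPoint s x ∈ cone := by
    by_contra h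
    exact hx (hg x h)
  have h2 : ‖x‖ + 1 < (hypPoint s x).1 := h1
  have h3 := hypPoint_time_sq (s := s) x
  rw [mem_closedBall_zero_iff]
  nlinarith [norm_nonneg x]

lemma density_eq_zero {w : Spacetime → ℝ} (hw : ConeSupported 1 w) {p : Spacetime}
    (hp : p ∉ cone) : density w p = 0 := by
  have h : ∀ α, pd α w p = 0 := fun α => (hw.fieldD (k := 0) (.inl α)).eq_zero hp
  simp [density, opK, hypDs, hypD, h, hw.eq_zero hp]

lemma continuous_density (hs : 0 < s) {w : Spacetime → ℝ} (hw : ConeSupported 1 w) :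
    Continuous fun x => density w (hypPoint s x) := by
  have hh : Continuous (hypPoint s) := (contDiff_hypPoint hs).continuous
  have h0 : Continuous fun x => w (hypPoint s x) := hw.contDiff.continuous.comp hh
  have h1 : ∀ α, Continuous fun x => pd α w (hypPoint s x) := fun α =>
    (hw.fieldD (k := 0) (.inl α)).contDiff.continuous.comp hh
  have h2 : ∀ x, (hypPoint s x).1 ≠ 0 := fun x => (hypPoint_time_pos hs x).ne'
  have h3 : Continuous fun x => (hypPoint s x).1 := continuous_fst.comp hh
  have h4 : ∀ a, Continuous fun x => hypD a w (hypPoint s x) := fun a =>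
    (Continuous.mul (Continuous.div (by simp only [hypPoint]; fun_prop) h3 h2) (h1 0)).add (h1 _)
  have h5 : Continuous fun x => s / (hypPoint s x).1 := continuous_const.div h3 h2
  have h6 : ∀ a, Continuous fun x => (hypPoint s x).2 a := fun a => by
    simp only [hypPoint]; fun_prop
  simp only [density, opK, hypDs, hypTime_hypPoint hs]
  exact ((continuous_finsetSum _ fun a _ => (continuous_const.mul (h4 a)).pow 2).add
    ((((continuous_const.mul (h5.mul (h1 0))).add (continuous_const.mul
      (continuous_finsetSum _ fun a _ => (h6 a).mul (h4 a)))).add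
        (continuous_const.mul h0)).pow 2)).add ((h5.mul h0).pow 2)

lemma integrable_density (hs : 0 < s) {w : Spacetime → ℝ} (hw : ConeSupported 1 w) :
    Integrable fun x => density w (hypPoint s x) :=
  (continuous_density hs hw).integrable_of_hasCompactSupport
    (hasCompactSupport_of_cone fun _ hx => density_eq_zero hw hx)

lemma energy_nonneg (s : ℝ) (w : Spacetime → ℝ) : 0 ≤ energy s w :=
  integral_nonneg fun x => by simp only [Pi.zero_apply]; positivity

/-- Hardy's inequality on `ℋ_s` bounds the integral of the energy density by the energy. -/
lemma integral_density_le (hs : 0 < s) {w : Spacetime → ℝ} (hw : ConeSupported 1 w) :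
    ∫ x, density w (hypPoint s x) ≤ 5 * energy s w := by
  have hd : Differentiable ℝ w := ConeSupported.differentiable (k := 0) hw
  have hc := hw.contDiff_comp hs
  have hsupp : HasCompactSupport fun x => w (hypPoint s x) :=
    hasCompactSupport_of_cone fun x hx => hw.eq_zero hx
  have hh : Continuous (hypPoint s) := (contDiff_hypPoint hs).continuous
  have hpd : ∀ {p}, p ∉ cone → ∀ α, pd α w p = 0 := fun hp α =>
    (hw.fieldD (k := 0) (.inl α)).eq_zero hp
  have hardy' := hardy hc hsupp hs
  simp only [fderiv_comp_hypPoint hs hd] at hardy'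
  -- the three pieces of the density
  set A := fun x => ∑ a : Fin 3, (s * hypD a w (hypPoint s x)) ^ 2 with hA
  set B := fun x => (opK w (hypPoint s x) + 2 * w (hypPoint s x)) ^ 2 with hB
  set D := fun x => (s / (hypPoint s x).1 * w (hypPoint s x)) ^ 2 with hD
  have hDc : ∀ a, Continuous fun x => hypD a w (hypPoint s x) := fun a => by
    simp only [← fderiv_comp_hypPoint hs hd]
    exact (hc.continuous_fderiv (by simp)).clm_apply continuous_const
  have iA : Integrable A := Continuous.integrable_of_hasCompactSupport (by fun_prop)
    (hasCompactSupport_of_cone (s := s) fun x hx => by simp [hA, hypD, hpd hx])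
  have iD : Integrable D := by
    refine Continuous.integrable_of_hasCompactSupport ?_
      (hasCompactSupport_of_cone (s := s) fun x hx => by simp [hD, hw.eq_zero hx])
    exact ((continuous_const.div (continuous_fst.comp hh) fun x =>
      (hypPoint_time_pos hs x).ne').mul hc.continuous).pow 2
  have hsum : (fun x => density w (hypPoint s x)) = fun x => A x + B x + D x := by
    funext x
    simp only [density, hypTime_hypPoint hs, hA, hB, hD]
  have iAB : Integrable fun x => A x + B x := by
    have := (integrable_density hs hw).sub iD
    rw [hsum] at this
    refine this.congr (.of_forall fun x => ?_)
    simp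
  have hE : energy s w = ∫ x, A x + B x := by
    rw [energy]
    refine setIntegral_eq_integral_of_forall_compl_eq_zero fun x hx => ?_
    simp [opK, hypDs, hypD, hpd hx, hw.eq_zero hx]
  have hAB : ∫ x, A x ≤ ∫ x, A x + B x :=
    integral_mono iA iAB fun x => le_add_of_nonneg_right (sq_nonneg _)
  have hDA : ∫ x, D x ≤ 4 * ∫ x, A x := by
    have e1 : ∫ x, D x = s ^ 2 * ∫ x, w (hypPoint s x) ^ 2 / (s ^ 2 + ‖x‖ ^ 2) := by
      rw [← integral_const_mul]
      refine integral_congr_ae (.of_forall fun x => ?_)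
      simp only [hD, mul_pow, div_pow, hypPoint_time_sq]
      ring
    have e2 : ∫ x, A x = s ^ 2 * ∫ x, ∑ a : Fin 3, hypD a w (hypPoint s x) ^ 2 := by
      rw [← integral_const_mul]
      refine integral_congr_ae (.of_forall fun x => ?_)
      simp only [hA, mul_pow, Finset.mul_sum]
    rw [e1, e2]
    nlinarith [sq_nonneg s]
  rw [hsum, integral_add iAB iD, hE]
  linarith

lemma energySum_eq_wordSum (N : ℕ) (s : ℝ) (u : Spacetime → ℝ) :
    energySum N s u = wordSum N fun I J => √(energy s (derivWord I J u)) := rfl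

lemma energySum_nonneg (N : ℕ) (s : ℝ) (u : Spacetime → ℝ) : 0 ≤ energySum N s u := by
  rw [energySum_eq_wordSum]
  exact wordSum_nonneg fun _ _ => Real.sqrt_nonneg _

variable {N : ℕ} {u : Spacetime → ℝ}

lemma coneSupported_derivWord_ofFn (hu : ConeSupported (N + 1) u) {i j : ℕ}
    (hi : i ∈ Finset.range (N + 1)) (hj : j ∈ Finset.range (N + 1 - i)) (I : Fin i → Fin 4)
    (J : Fin j → Fin 3) : ConeSupported 1 (derivWord (List.ofFn I) (List.ofFn J) u) := by
  rw [Finset.mem_range] at hi hj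
  exact hu.derivWord _ _ (by simp only [List.length_ofFn]; omega)

lemma continuous_totalDensity (hs : 0 < s) (hu : ConeSupported (N + 1) u) :
    Continuous fun x => totalDensity N u (hypPoint s x) :=
  continuous_finsetSum _ fun _ hi => continuous_finsetSum _ fun _ hj =>
    continuous_finsetSum _ fun I _ => continuous_finsetSum _ fun J _ =>
      continuous_density hs (coneSupported_derivWord_ofFn hu hi hj I J)

lemma integrable_totalDensity (hs : 0 < s) (hu : ConeSupported (N + 1) u) :
    Integrable fun x => totalDensity N u (hypPoint s x) :=
  integrable_finsetSum _ fun _ hi => integrable_finsetSum _ fun _ hj =>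
    integrable_finsetSum _ fun I _ => integrable_finsetSum _ fun J _ =>
      integrable_density hs (coneSupported_derivWord_ofFn hu hi hj I J)

lemma integral_totalDensity_le (hs : 0 < s) (hu : ConeSupported (N + 1) u) :
    ∫ x, totalDensity N u (hypPoint s x) ≤ 5 * energySum N s u ^ 2 := by
  have h1 : ∫ x, totalDensity N u (hypPoint s x)
      = wordSum N fun I J => ∫ x, density (derivWord I J u) (hypPoint s x) := by
    have hi := fun {i j} (hi : i ∈ Finset.range (N + 1)) (hj : j ∈ Finset.range (N + 1 - i)) I J =>
      integrable_density hs (coneSupported_derivWord_ofFn hu hi hj I J)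
    simp only [totalDensity, wordSum]
    rw [integral_finsetSum _ fun i h1 => integrable_finsetSum _ fun j h2 =>
      integrable_finsetSum _ fun I _ => integrable_finsetSum _ fun J _ => hi h1 h2 I J]
    refine Finset.sum_congr rfl fun i h1 => ?_
    rw [integral_finsetSum _ fun j h2 =>
      integrable_finsetSum _ fun I _ => integrable_finsetSum _ fun J _ => hi h1 h2 I J]
    refine Finset.sum_congr rfl fun j h2 => ?_
    rw [integral_finsetSum _ fun I _ => integrable_finsetSum _ fun J _ => hi h1 h2 I J]
    refine Finset.sum_congr rfl fun I _ => ?_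
    rw [integral_finsetSum _ fun J _ => hi h1 h2 I J]
  have h2 : wordSum N (fun I J => ∫ x, density (derivWord I J u) (hypPoint s x))
      ≤ wordSum N fun I J => √(energy s (derivWord I J u)) ^ 2 * 5 :=
    wordSum_mono fun I J h => by
      rw [Real.sq_sqrt (energy_nonneg _ _), mul_comm]
      exact integral_density_le hs (hu.derivWord I J (by omega))
  rw [h1, energySum_eq_wordSum]
  rw [wordSum_mul] at h2
  have h3 := wordSum_sq_le N (F := fun I J => √(energy s (derivWord I J u)))
    fun _ _ => Real.sqrt_nonneg _
  linarith

end restriction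

/-! ### The Klainerman–Sobolev inequality on hyperboloids -/

section klainermanSobolev

open MeasureTheory

lemma apply_eq_sum_coord (L : EuclideanSpace ℝ (Fin 3) →L[ℝ] ℝ) (v : EuclideanSpace ℝ (Fin 3)) :
    L v = ∑ a, v a * L (EuclideanSpace.single a 1) := by
  conv_lhs => rw [← (EuclideanSpace.basisFun (Fin 3) ℝ).sum_repr v]
  simp

lemma abs_sum_coord_le {v : EuclideanSpace ℝ (Fin 3)} (hv : ‖v‖ = 1) {c : Fin 3 → ℝ} {M : ℝ}
    (hc : ∀ a, |c a| ≤ M) : |∑ a, v a * c a| ≤ 3 * M := by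
  refine (Finset.abs_sum_le_sum_abs _ _).trans ?_
  calc ∑ a, |v a * c a| ≤ ∑ _a : Fin 3, M := Finset.sum_le_sum fun a _ => by
        rw [abs_mul]
        exact (mul_le_of_le_one_left (abs_nonneg _) (hv ▸ abs_coord_le v a)).trans (hc a)
    _ = 3 * M := by simp

/-- The Klainerman–Sobolev inequality on `ℋ_s`, localized to a ball of radius comparable to `t`:
there `t ∂̲_a = L_a`, so that the scaled Sobolev inequality involves boosts only. -/
theorem exists_klainerman_sobolev : ∃ C : ℝ, 0 ≤ C ∧
    ∀ (F : Spacetime → ℝ) (D : EuclideanSpace ℝ (Fin 3) → ℝ) (s : ℝ)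
      (x₀ : EuclideanSpace ℝ (Fin 3)), 0 < s → ConeSupported 2 F → Continuous D → Integrable D →
      (∀ x, 0 ≤ D x) →
      (∀ x, ‖x - x₀‖ < (hypPoint s x₀).1 / 2 → hypPoint s x ∈ cone →
        F (hypPoint s x) ^ 2 ≤ D x ∧ (∀ a, boost a F (hypPoint s x) ^ 2 ≤ D x) ∧
          ∀ a b, boost a (boost b F) (hypPoint s x) ^ 2 ≤ D x) →
      (hypPoint s x₀).1 ^ 3 * F (hypPoint s x₀) ^ 2 ≤ C * ∫ x, D x := by
  obtain ⟨C, hC, hsob⟩ := exists_sobolev_ball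
  refine ⟨8 * 324 * C, by positivity, fun F D s x₀ hs hF hD hDi hD0 hb => ?_⟩
  set R := (hypPoint s x₀).1 / 2 with hR
  have hR0 : 0 < R := half_pos (hypPoint_time_pos hs x₀)
  have hdF : Differentiable ℝ F := ConeSupported.differentiable (k := 1) hF
  have hdD : ∀ b, Differentiable ℝ (hypD b F) := fun b =>
    ConeSupported.differentiable (k := 0) (hF.hypD b)
  have hRt : ∀ x, ‖x - x₀‖ < R → R ≤ (hypPoint s x).1 := fun x hx => by
    have := hypPoint_time_le (s := s) x x₀
    rw [norm_sub_rev] at this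
    linarith
  -- bounds for the derivatives along the hyperboloid
  have bnd : ∀ x, ‖x - x₀‖ < R → |F (hypPoint s x)| ≤ √(D x) ∧
      (∀ a, |R * hypD a F (hypPoint s x)| ≤ √(D x)) ∧
      ∀ a b, |R ^ 2 * hypD a (hypD b F) (hypPoint s x)| ≤ 2 * √(D x) := fun x hx => by
    by_cases hp : hypPoint s x ∈ cone
    · obtain ⟨b0, b1, b2⟩ := hb x hx hp
      set p := hypPoint s x
      have hp1 := cone_time_pos hp
      have hRp : |R / p.1| ≤ 1 := by
        rw [abs_of_pos (by positivity), div_le_one (by positivity)]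
        exact hRt x hx
      have c1 := fun a => Real.abs_le_sqrt (b1 a)
      have c2 := fun a b => Real.abs_le_sqrt (b2 a b)
      refine ⟨Real.abs_le_sqrt b0, fun a => ?_, fun a b => ?_⟩
      · rw [hypD_eq_boost a F hp, ← mul_assoc, ← div_eq_mul_inv, abs_mul]
        exact (mul_le_of_le_one_left (abs_nonneg _) hRp).trans (c1 a)
      · have e : R ^ 2 * hypD a (hypD b F) p
            = (R / p.1) ^ 2 * (boost b (boost a F) p + -(p.2 b / p.1) * boost a F p) := by
          rw [hypD_eq_boost a _ hp, boost_hypD hF a b hp, hypD_eq_boost a _ hp,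
            hypD_eq_boost b _ hp]
          field_simp
        have hx1 : |-(p.2 b / p.1)| ≤ 1 := by
          have h2 : ‖p.2‖ + 1 < p.1 := hp
          rw [abs_neg, abs_div, abs_of_pos (by linarith : 0 < p.1), div_le_one (by linarith)]
          linarith [abs_coord_le p.2 b]
        rw [e, abs_mul, abs_pow]
        refine (mul_le_of_le_one_left (abs_nonneg _) (pow_le_one₀ (abs_nonneg _) hRp)).trans ?_
        refine (abs_add_le _ _).trans ?_
        rw [abs_mul]
        have := (mul_le_of_le_one_left (abs_nonneg (boost a F p)) hx1).trans (c1 a)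
        linarith [c2 b a]
    · have h1 : ∀ a, hypD a F (hypPoint s x) = 0 := fun a => (hF.hypD (k := 1) a).eq_zero hp
      have h2 : ∀ a b, hypD a (hypD b F) (hypPoint s x) = 0 := fun a b =>
        ((hF.hypD (k := 1) b).hypD (k := 0) a).eq_zero hp
      simp [hF.eq_zero hp, h1, h2]
  have hf' : ∀ x v, fderiv ℝ (fun y => F (hypPoint s y)) x v
      = ∑ a, v a * hypD a F (hypPoint s x) := fun x v => by
    simp only [apply_eq_sum_coord _ v, fderiv_comp_hypPoint hs hdF]
  have hf2 : ContDiff ℝ 2 fun y => F (hypPoint s y) := hF.contDiff_comp hs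
  have hf'' : ∀ x v, fderiv ℝ (fderiv ℝ fun y => F (hypPoint s y)) x v v
      = ∑ b, v b * ∑ a, v a * hypD a (hypD b F) (hypPoint s x) := fun x v => by
    have hd : DifferentiableAt ℝ (fderiv ℝ fun y => F (hypPoint s y)) x :=
      (hf2.fderiv_right (m := 1) (by norm_num)).differentiable (by simp) x
    have h3 : ∀ w v', fderiv ℝ (fun y => fderiv ℝ (fun y => F (hypPoint s y)) y w) x v'
        = fderiv ℝ (fderiv ℝ fun y => F (hypPoint s y)) x v' w := fun w v' => by
      rw [fderiv_clm_apply hd (by fun_prop)]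
      simp
    rw [apply_eq_sum_coord]
    refine Finset.sum_congr rfl fun b _ => ?_
    rw [← h3]
    simp only [fderiv_comp_hypPoint hs hdF]
    rw [apply_eq_sum_coord]
    simp only [fderiv_comp_hypPoint hs (hdD b)]
  -- the second derivatives carry the largest constant, `3 · 3 · 2 = 18`, and `18² = 324`
  have hsq : ∀ {y M : ℝ} {x}, |y| ≤ M * √(D x) → 0 ≤ M → M ≤ 18 → y ^ 2 ≤ 324 * D x :=
    fun {y M x} h hM hM' => by
      have h1 : |y| ≤ 18 * √(D x) := h.trans (by gcongr)
      calc y ^ 2 ≤ (18 * √(D x)) ^ 2 := sq_le_sq.2 (h1.trans (le_abs_self _))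
        _ = 324 * D x := by rw [mul_pow, Real.sq_sqrt (hD0 x)]; norm_num
  have key := hsob (fun y => F (hypPoint s y)) (fun x => 324 * D x) x₀ R hR0 hf2 (by fun_prop)
    (hDi.const_mul 324) (fun x => by have := hD0 x; positivity)
    (fun x hx => hsq (M := 1) (by simpa using (bnd x (mem_ball_iff_norm.1 hx)).1)
      zero_le_one (by norm_num))
    (fun x hx v hv => by
      rw [hf' x v, Finset.mul_sum]
      refine hsq (M := 3) ?_ (by norm_num) (by norm_num)
      have := abs_sum_coord_le hv (bnd x (mem_ball_iff_norm.1 hx)).2.1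
      refine le_trans (le_of_eq ?_) this
      congr 1
      exact Finset.sum_congr rfl fun a _ => by ring)
    (fun x hx v hv => by
      rw [hf'' x v]
      refine hsq (M := 18) ?_ (by norm_num) le_rfl
      have := abs_sum_coord_le hv fun b => abs_sum_coord_le hv fun a =>
        (bnd x (mem_ball_iff_norm.1 hx)).2.2 a b
      refine le_trans (le_of_eq ?_) (this.trans_eq (by ring))
      congr 1
      rw [Finset.mul_sum]
      refine Finset.sum_congr rfl fun b _ => ?_
      rw [← mul_assoc, mul_comm (R ^ 2), mul_assoc, Finset.mul_sum]
      congr 1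
      exact Finset.sum_congr rfl fun a _ => by ring)
  rw [integral_const_mul] at key
  have e : (hypPoint s x₀).1 ^ 3 = 8 * R ^ 3 := by rw [hR]; ring
  rw [e]
  linarith

end klainermanSobolev

/-! ### Pointwise decay -/

/-- A bound which is monotone in its constant holds with a common constant on a finite set. -/
lemma exists_uniform_const {ι : Type*} {S : Set ι} (hS : S.Finite) {q : ι → ℝ → Prop}
    (hq : ∀ i C D, C ≤ D → q i C → q i D) (h : ∀ i ∈ S, ∃ C, 0 ≤ C ∧ q i C) :
    ∃ C, 0 ≤ C ∧ ∀ i ∈ S, q i C := by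
  choose! c hc0 hc using h
  refine ⟨∑ i ∈ hS.toFinset, c i, Finset.sum_nonneg fun i hi => hc0 i (hS.mem_toFinset.1 hi),
    fun i hi => hq i _ _ ?_ (hc i hi)⟩
  exact Finset.single_le_sum (fun i hi => hc0 i (hS.mem_toFinset.1 hi)) (hS.mem_toFinset.2 hi)

lemma DensityBound.uniform {ι : Type*} [Finite ι] {N : ℕ} {ρ : Spacetime → ℝ} {P : ι → Operator}
    (h : ∀ i, DensityBound N ρ (P i)) :
    ∃ C : ℝ, 0 ≤ C ∧ ∀ i u, ConeSupported (N + 1) u → ∀ p ∈ cone,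
      (ρ p * P i u p) ^ 2 ≤ C * totalDensity N u p := by
  obtain ⟨C, hC, h⟩ := exists_uniform_const (Set.finite_univ (α := ι))
    (q := fun i C => ∀ u, ConeSupported (N + 1) u → ∀ p ∈ cone,
      (ρ p * P i u p) ^ 2 ≤ C * totalDensity N u p)
    (fun i C D hCD hi u hu p hp => (hi u hu p hp).trans
      (mul_le_mul_of_nonneg_right hCD (totalDensity_nonneg N u p))) fun i _ => h i
  exact ⟨C, hC, fun i => h i (Set.mem_univ i)⟩

/-- `|P u|`, multiplied by the weight `μ(s, t)`, is bounded by the energies, uniformly in `u`. -/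
def DecayBound (N : ℕ) (μ : ℝ → ℝ → ℝ) (P : Operator) (C : ℝ) : Prop :=
  ∀ u, ConeSupported (N + 1) u → ∀ s, 0 < s → ∀ p ∈ hyperboloid s ∩ cone,
    μ s p.1 * |P u p| ≤ C * energySum N s u

lemma DecayBound.mono {N : ℕ} {μ : ℝ → ℝ → ℝ} {P : Operator} {C D : ℝ} (h : DecayBound N μ P C)
    (hCD : C ≤ D) : DecayBound N μ P D := fun u hu s hs p hp =>
  (h u hu s hs p hp).trans (mul_le_mul_of_nonneg_right hCD (energySum_nonneg N s u))

/-- The Klainerman–Sobolev inequality applied to `P u`: the boosts of `P u` are combinations of the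
same kind, whose densities are integrable by the energy bounds. The weight `ρ` may be moved inside
the integral because `t` varies by a factor of at most two over the ball. -/
lemma exists_decayBound {N n : ℕ} {G : ℕ → Operator → Prop} {ρ : Spacetime → ℝ} {P : Operator}
    (hG : IsStableClass (N + 1) N G) (hP : Comb (N + 1) Coeff G n P) (hn : n + 2 ≤ N)
    (hb : ∀ {m Q}, m ≤ N → Comb (N + 1) Coeff G m Q → DensityBound N ρ Q) {μ : ℝ → ℝ → ℝ}
    (hμ : ∀ s, 0 < s → ∀ x, ρ (hypPoint s x) = μ s (hypPoint s x).1)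
    (hμ0 : ∀ s t, 0 < s → 0 < t → 0 < μ s t)
    (hμ2 : ∀ s t t', 0 < s → 0 < t → t ≤ 2 * t' → μ s t' ≤ 2 * μ s t) :
    ∃ C, 0 ≤ C ∧ DecayBound N (fun s t => μ s t * t ^ (3 / 2 : ℝ)) P C := by
  obtain ⟨K, hK, hks⟩ := exists_klainerman_sobolev
  have d1 : ∀ a, Comb (N + 1) Coeff G (n + 1) fun u => boost a (P u) := fun a => by
    simpa only [fieldD_inr] using hP.fieldD_of_stable hG (.inr a) (by omega)
  have d2 : ∀ ab : Fin 3 × Fin 3, Comb (N + 1) Coeff G (n + 1 + 1)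
      fun u => boost ab.1 (boost ab.2 (P u)) := fun ab => by
    simpa only [fieldD_inr] using (d1 ab.2).fieldD_of_stable hG (.inr ab.1) (by omega)
  obtain ⟨C0, hC0, b0⟩ := hb (by omega) hP
  obtain ⟨C1, hC1, b1⟩ := DensityBound.uniform fun a => hb (by omega) (d1 a)
  obtain ⟨C2, hC2, b2⟩ := DensityBound.uniform fun ab => hb (by omega) (d2 ab)
  set M := 4 * (C0 + C1 + C2) with hM
  refine ⟨√(K * M * 5), Real.sqrt_nonneg _, fun u hu s hs p hp => ?_⟩
  obtain ⟨f, hf, hPf⟩ := hP.exists_coneSupported isCoeffClass_coeff hG.toIsGenClass (k := 2) hn hu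
  have hp' := eq_hypPoint hp.1
  set x₀ := p.2
  have ht0 := hypPoint_time_pos hs x₀
  have hm0 := hμ0 s _ hs ht0
  set m := μ s (hypPoint s x₀).1 with hm
  -- a function of `P u` which obeys the weighted bound at `x` obeys the bound with weight `m`
  have tr : ∀ {x : EuclideanSpace ℝ (Fin 3)} {y C : ℝ},
      (hypPoint s x).1 ≤ 2 * (hypPoint s x₀).1 → 0 ≤ C → C ≤ C0 + C1 + C2 →
      (ρ (hypPoint s x) * y) ^ 2 ≤ C * totalDensity N u (hypPoint s x) →
      y ^ 2 ≤ M / m ^ 2 * totalDensity N u (hypPoint s x) := fun {x y C} hx hC hC' hy => by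
    have h1 := hμ2 s _ _ hs (hypPoint_time_pos hs x) hx
    rw [hμ s hs, mul_pow] at hy
    rw [div_mul_eq_mul_div, le_div_iff₀ (by positivity)]
    have h2 : m ^ 2 ≤ 4 * μ s (hypPoint s x).1 ^ 2 := by
      calc m ^ 2 ≤ (2 * μ s (hypPoint s x).1) ^ 2 := pow_le_pow_left₀ hm0.le h1 2
        _ = 4 * μ s (hypPoint s x).1 ^ 2 := by ring
    have h3 := mul_le_mul_of_nonneg_right hC' (totalDensity_nonneg N u (hypPoint s x))
    have h4 := mul_le_mul_of_nonneg_left h2 (sq_nonneg y)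
    linarith
  have e1 : ∀ a, Set.EqOn (boost a f) (boost a (P u)) cone := fun a => by
    simpa only [fieldD_inr] using fieldD_congr hPf.symm (.inr a)
  have e2 : ∀ a b, Set.EqOn (boost a (boost b f)) (boost a (boost b (P u))) cone := fun a b => by
    simpa only [fieldD_inr] using fieldD_congr (e1 b) (.inr a)
  have key := hks f (fun x => M / m ^ 2 * totalDensity N u (hypPoint s x)) s x₀ hs hf
    (continuous_const.mul (continuous_totalDensity hs hu))
    ((integrable_totalDensity hs hu).const_mul _)
    (fun x => mul_nonneg (by positivity) (totalDensity_nonneg _ _ _))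
    (fun x hx hxc => by
      have hxt : (hypPoint s x).1 ≤ 2 * (hypPoint s x₀).1 := by
        have := hypPoint_time_le (s := s) x₀ x
        linarith
      refine ⟨?_, fun a => ?_, fun a b => ?_⟩
      · rw [← hPf hxc]
        exact tr hxt hC0 (by linarith) (b0 u hu _ hxc)
      · rw [e1 a hxc]
        exact tr hxt hC1 (by linarith) (b1 a u hu _ hxc)
      · rw [e2 a b hxc]
        exact tr hxt hC2 (by linarith) (b2 (a, b) u hu _ hxc))
  have hPp : P u p = f p := hPf hp.2
  have hE := integral_totalDensity_le hs hu
  have hE0 := energySum_nonneg N s u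
  rw [MeasureTheory.integral_const_mul, ← hp'] at key
  have hpt : (hypPoint s x₀).1 = p.1 := congrArg Prod.fst hp'.symm
  have hm' : m = μ s p.1 := by rw [hm, hpt]
  rw [hpt] at ht0
  have hsq : (μ s p.1 * p.1 ^ (3 / 2 : ℝ) * |P u p|) ^ 2 ≤ (√(K * M * 5) * energySum N s u) ^ 2 := by
    have h1 : (p.1 ^ (3 / 2 : ℝ)) ^ 2 = p.1 ^ 3 := by
      rw [← Real.rpow_natCast, ← Real.rpow_mul ht0.le, ← Real.rpow_natCast]
      norm_num
    rw [mul_pow, mul_pow, mul_pow, h1, sq_abs, hPp, Real.sq_sqrt (by positivity), ← hm']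
    calc m ^ 2 * p.1 ^ 3 * f p ^ 2 = m ^ 2 * (p.1 ^ 3 * f p ^ 2) := by ring
      _ ≤ m ^ 2 * (K * (M / m ^ 2 * ∫ x, totalDensity N u (hypPoint s x))) := by gcongr
      _ = K * M * ∫ x, totalDensity N u (hypPoint s x) := by field_simp
      _ ≤ K * M * (5 * energySum N s u ^ 2) := by gcongr
      _ = K * M * 5 * energySum N s u ^ 2 := by ring
  exact (le_abs_self _).trans (abs_le_of_sq_le_sq hsq (by positivity))

section classes

variable {N n : ℕ} {P : Operator}

lemma exists_decayBound_word (hn : n + 2 ≤ N) (hP : Comb (N + 1) Coeff WordClass n P) :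
    ∃ C, 0 ≤ C ∧ DecayBound N (fun s t => s / t * t ^ (3 / 2 : ℝ)) P C :=
  exists_decayBound (μ := fun s t => s / t) (isStableClass_word N) hP hn densityBound_word
    (fun s hs x => by rw [hypTime_hypPoint hs]) (fun s t hs ht => by positivity)
    fun s t t' hs ht h => by
      have : 0 < t' := by linarith
      rw [mul_div_assoc', div_le_div_iff₀ this ht]
      nlinarith

lemma exists_decayBound_tangential (hn : n + 2 ≤ N)
    (hP : Comb (N + 1) Coeff TangentialClass n P) :
    ∃ C, 0 ≤ C ∧ DecayBound N (fun s t => s * t ^ (3 / 2 : ℝ)) P C :=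
  exists_decayBound (μ := fun s _ => s) (isStableClass_tangential N) hP hn
    densityBound_tangential (fun s hs x => hypTime_hypPoint hs x) (fun s t hs ht => hs)
    fun s t t' hs ht h => by linarith

lemma exists_decayBound_transversal (hn : n + 2 ≤ N)
    (hP : Comb (N + 1) Coeff TransversalClass n P) :
    ∃ C, 0 ≤ C ∧ DecayBound N (fun s t => s ^ 2 / t * t ^ (3 / 2 : ℝ)) P C :=
  exists_decayBound (μ := fun s t => s ^ 2 / t) (isStableClass_transversal N) hP hn
    densityBound_transversal (fun s hs x => by rw [hypTime_hypPoint hs])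
    (fun s t hs ht => by positivity)
    fun s t t' hs ht h => by
      have : 0 < t' := by linarith
      rw [mul_div_assoc', div_le_div_iff₀ this ht]
      nlinarith [sq_nonneg s]

/-- Changes the form of the weight and of the operator in a decay bound. -/
lemma DecayBound.exists_congr {μ ν : ℝ → ℝ → ℝ} {Q : Operator}
    (h : ∃ C, 0 ≤ C ∧ DecayBound N μ P C)
    (hν : ∀ s t, 0 < t → ∀ u p, p.1 = t → ν s t * |Q u p| = μ s t * |P u p|) :
    ∃ C, 0 ≤ C ∧ DecayBound N ν Q C := by
  obtain ⟨C, hC, h⟩ := h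
  refine ⟨C, hC, fun u hu s hs p hp => ?_⟩
  rw [hν s p.1 (by linarith [cone_time_pos hp.2]) u p rfl]
  exact h u hu s hs p hp

end classes

lemma div_mul_rpow_three_half {t : ℝ} (ht : 0 < t) (c : ℝ) :
    c / t * t ^ (3 / 2 : ℝ) = c * t ^ (1 / 2 : ℝ) := by
  rw [show (3 / 2 : ℝ) = 1 / 2 + 1 by norm_num, Real.rpow_add_one ht.ne']
  field_simp

lemma mul_rpow_five_half {t : ℝ} (ht : 0 < t) : t ^ (5 / 2 : ℝ) = t ^ (3 / 2 : ℝ) * t := by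
  rw [show (5 / 2 : ℝ) = 3 / 2 + 1 by norm_num, Real.rpow_add_one ht.ne']

section estimates

variable {N : ℕ} {W W' : List FieldIndex}

lemma exists_decay_word (h : W.length + 2 ≤ N) :
    ∃ C, 0 ≤ C ∧ DecayBound N (fun s t => s * t ^ (1 / 2 : ℝ)) (wordD W) C :=
  DecayBound.exists_congr (exists_decayBound_word h (.of_gen isCoeffClass_coeff ⟨W, le_rfl⟩))
    fun s t ht u p _ => by rw [div_mul_rpow_three_half ht]

lemma exists_decay_hypD (a : Fin 3) (h : W.length + W'.length + 2 ≤ N) :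
    ∃ C, 0 ≤ C ∧ DecayBound N (fun s t => s * t ^ (3 / 2 : ℝ))
      (fun u => wordD W (hypD a (wordD W' u))) C :=
  exists_decayBound_tangential h (comb_wordD_hypD W W' a (by omega))

lemma exists_decay_hypDs (h : W.length + W'.length + 2 ≤ N) :
    ∃ C, 0 ≤ C ∧ DecayBound N (fun s t => s ^ 2 * t ^ (1 / 2 : ℝ))
      (fun u => wordD W (hypDs (wordD W' u))) C :=
  DecayBound.exists_congr (exists_decayBound_transversal h (comb_wordD_hypDs W W' (by omega)))
    fun s t ht u p _ => by rw [div_mul_rpow_three_half ht]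

lemma exists_decay_hypD_hypD (a b : Fin 3) (h : W.length + W'.length + 3 ≤ N) :
    ∃ C, 0 ≤ C ∧ DecayBound N (fun s t => s * t ^ (5 / 2 : ℝ))
      (fun u => wordD W (hypD a (hypD b (wordD W' u)))) C :=
  DecayBound.exists_congr (exists_decayBound_tangential (by omega)
    (comb_time_mul_wordD_hypD_hypD W W' a b (by omega)))
    fun s t ht u p hp => by
      rw [hp, abs_mul, abs_of_pos ht, mul_rpow_five_half ht]
      ring

lemma exists_decay_hypDs_hypD (a : Fin 3) (h : W.length + W'.length + 3 ≤ N) :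
    ∃ C, 0 ≤ C ∧ DecayBound N (fun s t => s ^ 2 * t ^ (3 / 2 : ℝ))
      (fun u => wordD W (hypDs (hypD a (wordD W' u)))) C :=
  DecayBound.exists_congr (exists_decayBound_transversal (by omega)
    (comb_time_mul_wordD_hypDs_hypD W W' a (by omega)))
    fun s t ht u p hp => by
      rw [hp, abs_mul, abs_of_pos ht]
      field_simp

end estimates

/-! ### Extension by zero -/

section extension

variable {u v : Spacetime → ℝ}

/-- A function which is of class `C^k` in the cone and vanishes near its boundary may be extended
by zero to a function of class `C^k` on the whole space-time. -/
lemma exists_coneSupported_eqOn {k : ℕ} (hu : ContDiffOn ℝ k u cone)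
    (hv : VanishesNearConeBoundary u) : ∃ v, ConeSupported k v ∧ Set.EqOn u v cone := by
  obtain ⟨U, hU, hUb, hU0⟩ := hv
  have hind : Set.EqOn u (cone.indicator u) cone := fun p hp => (Set.indicator_of_mem hp u).symm
  -- the extension vanishes on an open set which contains the complement of the cone
  have hzero : ∀ p ∉ cone, cone.indicator u =ᶠ[𝓝 p] 0 := fun p hp => by
    have hle : p.1 ≤ ‖p.2‖ + 1 := not_lt.1 hp
    rcases hle.eq_or_lt with h | h
    · filter_upwards [hU.mem_nhds (hUb h)] with q hq
      by_cases hqc : q ∈ cone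
      · rw [← hind hqc]; exact hU0 q ⟨hq, hqc⟩
      · simp [hqc]
    · have ho : IsOpen {q : Spacetime | q.1 < ‖q.2‖ + 1} := isOpen_lt (by fun_prop) (by fun_prop)
      filter_upwards [ho.mem_nhds h] with q hq
      have : q ∉ cone := fun hqc => lt_asymm hq hqc
      simp [this]
  refine ⟨_, ⟨contDiff_iff_contDiffAt.2 fun p => ?_, fun p hp => ?_⟩, hind⟩
  · by_cases hp : p ∈ cone
    · exact (hu.contDiffAt (isOpen_cone.mem_nhds hp)).congr_of_eventuallyEq
        (hind.symm.eventuallyEq_of_mem (isOpen_cone.mem_nhds hp))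
    · exact contDiffAt_const.congr_of_eventuallyEq (hzero p hp)
  · by_contra h
    exact (notMem_tsupport_iff_eventuallyEq.2 (hzero p h)) hp

lemma hypD_congr (h : Set.EqOn u v cone) (a : Fin 3) : Set.EqOn (hypD a u) (hypD a v) cone :=
  fun p hp => by
    have h1 : ∀ α, pd α u p = pd α v p := fun α => fieldD_congr h (.inl α) hp
    simp only [hypD, h1]

lemma hypDs_congr (h : Set.EqOn u v cone) : Set.EqOn (hypDs u) (hypDs v) cone := fun p hp => by
  have h1 : ∀ α, pd α u p = pd α v p := fun α => fieldD_congr h (.inl α) hp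
  simp only [hypDs, h1]

lemma derivWord_congr (h : Set.EqOn u v cone) (I : List (Fin 4)) (J : List (Fin 3)) :
    Set.EqOn (derivWord I J u) (derivWord I J v) cone := by
  simp only [derivWord_eq_wordD]
  exact wordD_congr h _

lemma energy_congr (s : ℝ) (h : Set.EqOn u v cone) : energy s u = energy s v := by
  by_cases hm : MeasurableSet {x : EuclideanSpace ℝ (Fin 3) | hypPoint s x ∈ cone}
  · refine MeasureTheory.setIntegral_congr_fun hm fun x hx => ?_
    have hK : opK u (hypPoint s x) = opK v (hypPoint s x) := by
      simp only [opK, hypDs_congr h hx, hypD_congr h _ hx]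
    simp only [hK, hypD_congr h _ hx, h hx]
  · refine absurd (isOpen_cone.measurableSet.preimage (f := hypPoint s) ?_) hm
    unfold hypPoint
    fun_prop

lemma energySum_congr (N : ℕ) (s : ℝ) (h : Set.EqOn u v cone) :
    energySum N s u = energySum N s v := by
  simp only [energySum, energy_congr s (derivWord_congr h _ _)]

end extension

/-- The decay estimates in which at most one hyperbolic derivative is applied. -/
structure FirstEstimates (N : ℕ) (I : List (Fin 4)) (J : List (Fin 3)) (C : ℝ) : Prop where
  word : DecayBound N (fun s t => s * t ^ (1 / 2 : ℝ)) (derivWord I J) C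
  hypD_word : ∀ a, DecayBound N (fun s t => s * t ^ (3 / 2 : ℝ))
    (fun u => hypD a (derivWord I J u)) C
  hypDs_word : DecayBound N (fun s t => s ^ 2 * t ^ (1 / 2 : ℝ)) (fun u => hypDs (derivWord I J u)) C
  word_hypD : ∀ a, DecayBound N (fun s t => s * t ^ (3 / 2 : ℝ))
    (fun u => derivWord I J (hypD a u)) C
  word_hypDs : DecayBound N (fun s t => s ^ 2 * t ^ (1 / 2 : ℝ)) (fun u => derivWord I J (hypDs u)) C

/-- The decay estimates in which two hyperbolic derivatives are applied. -/
structure SecondEstimates (N : ℕ) (I : List (Fin 4)) (J : List (Fin 3)) (C : ℝ) : Prop where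
  hypDs_hypD_word : ∀ a, DecayBound N (fun s t => s ^ 2 * t ^ (3 / 2 : ℝ))
    (fun u => hypDs (hypD a (derivWord I J u))) C
  hypD_hypD_word : ∀ ab : Fin 3 × Fin 3, DecayBound N (fun s t => s * t ^ (5 / 2 : ℝ))
    (fun u => hypD ab.1 (hypD ab.2 (derivWord I J u))) C
  word_hypDs_hypD : ∀ a, DecayBound N (fun s t => s ^ 2 * t ^ (3 / 2 : ℝ))
    (fun u => derivWord I J (hypDs (hypD a u))) C
  word_hypD_hypD : ∀ ab : Fin 3 × Fin 3, DecayBound N (fun s t => s * t ^ (5 / 2 : ℝ))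
    (fun u => derivWord I J (hypD ab.1 (hypD ab.2 u))) C

lemma DecayBound.uniform {ι : Type} [Finite ι] {N : ℕ} {μ : ℝ → ℝ → ℝ} {P : ι → Operator}
    (h : ∀ i, ∃ C, 0 ≤ C ∧ DecayBound N μ (P i) C) :
    ∃ C, 0 ≤ C ∧ ∀ i, DecayBound N μ (P i) C := by
  obtain ⟨C, hC, h⟩ := exists_uniform_const (Set.finite_univ (α := ι))
    (q := fun i C => DecayBound N μ (P i) C) (fun i C D hCD hi => hi.mono hCD) fun i _ => h i
  exact ⟨C, hC, fun i => h i (Set.mem_univ i)⟩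

lemma FirstEstimates.mono {N : ℕ} {I : List (Fin 4)} {J : List (Fin 3)} {C D : ℝ}
    (h : FirstEstimates N I J C) (hCD : C ≤ D) : FirstEstimates N I J D :=
  ⟨h.1.mono hCD, fun a => (h.2 a).mono hCD, h.3.mono hCD, fun a => (h.4 a).mono hCD, h.5.mono hCD⟩

lemma SecondEstimates.mono {N : ℕ} {I : List (Fin 4)} {J : List (Fin 3)} {C D : ℝ}
    (h : SecondEstimates N I J C) (hCD : C ≤ D) : SecondEstimates N I J D :=
  ⟨fun a => (h.1 a).mono hCD, fun a => (h.2 a).mono hCD, fun a => (h.3 a).mono hCD,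
    fun a => (h.4 a).mono hCD⟩

lemma derivWord_eq (I : List (Fin 4)) (J : List (Fin 3)) :
    derivWord I J = wordD (I.map .inl ++ J.map .inr) :=
  funext (derivWord_eq_wordD I J)

lemma exists_firstEstimates {N : ℕ} {I : List (Fin 4)} {J : List (Fin 3)}
    (h : I.length + J.length + 2 ≤ N) : ∃ C, 0 ≤ C ∧ FirstEstimates N I J C := by
  set W : List FieldIndex := I.map .inl ++ J.map .inr with hWdef
  have hl : W.length = I.length + J.length := by simp [hWdef]
  rw [← hl] at h
  obtain ⟨C1, h1, b1⟩ := exists_decay_word h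
  obtain ⟨C2, h2, b2⟩ := DecayBound.uniform fun a =>
    exists_decay_hypD (W := []) (W' := W) a (by simpa using h)
  obtain ⟨C3, h3, b3⟩ := exists_decay_hypDs (W := []) (W' := W) (by simpa using h)
  obtain ⟨C4, h4, b4⟩ := DecayBound.uniform fun a =>
    exists_decay_hypD (W := W) (W' := []) a (by simpa using h)
  obtain ⟨C5, h5, b5⟩ := exists_decay_hypDs (W := W) (W' := []) (by simpa using h)
  refine ⟨C1 + C2 + C3 + C4 + C5, by positivity, ?_⟩
  constructor <;> simp only [derivWord_eq, ← hWdef]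
  · exact b1.mono (by linarith)
  · exact fun a => (b2 a).mono (by linarith)
  · exact b3.mono (by linarith)
  · exact fun a => (b4 a).mono (by linarith)
  · exact b5.mono (by linarith)

lemma exists_secondEstimates {N : ℕ} {I : List (Fin 4)} {J : List (Fin 3)}
    (h : I.length + J.length + 3 ≤ N) : ∃ C, 0 ≤ C ∧ SecondEstimates N I J C := by
  set W : List FieldIndex := I.map .inl ++ J.map .inr with hWdef
  have hl : W.length = I.length + J.length := by simp [hWdef]
  rw [← hl] at h
  obtain ⟨C1, h1, b1⟩ := DecayBound.uniform fun a =>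
    exists_decay_hypDs_hypD (W := []) (W' := W) a (by simpa using h)
  obtain ⟨C2, h2, b2⟩ := DecayBound.uniform fun ab : Fin 3 × Fin 3 =>
    exists_decay_hypD_hypD (W := []) (W' := W) ab.1 ab.2 (by simpa using h)
  obtain ⟨C3, h3, b3⟩ := DecayBound.uniform fun a =>
    exists_decay_hypDs_hypD (W := W) (W' := []) a (by simpa using h)
  obtain ⟨C4, h4, b4⟩ := DecayBound.uniform fun ab : Fin 3 × Fin 3 =>
    exists_decay_hypD_hypD (W := W) (W' := []) ab.1 ab.2 (by simpa using h)
  refine ⟨C1 + C2 + C3 + C4, by positivity, ?_⟩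
  constructor <;> simp only [derivWord_eq, ← hWdef]
  · exact fun a => (b1 a).mono (by linarith)
  · exact fun ab => (b2 ab).mono (by linarith)
  · exact fun a => (b3 a).mono (by linarith)
  · exact fun ab => (b4 ab).mono (by linarith)

lemma finite_words (k N : ℕ) :
    {IJ : List (Fin 4) × List (Fin 3) | IJ.1.length + IJ.2.length + k ≤ N}.Finite :=
  ((List.finite_length_le (Fin 4) N).prod (List.finite_length_le (Fin 3) N)).subset
    fun IJ h => by
      simp only [Set.mem_ofPred_eq] at h
      exact ⟨show IJ.1.length ≤ N by omega, show IJ.2.length ≤ N by omega⟩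

end HypConformal

end

open HypConformal
theorem mainTheorem7 (N : ℕ) :
    ∃ C : ℝ, 0 < C ∧
      ∀ u : Spacetime → ℝ,
        ContDiffOn ℝ ((N + 1 : ℕ) : WithTop ℕ∞) u cone →
        VanishesNearConeBoundary u →
        ∀ s : ℝ, 0 < s → ∀ p ∈ hyperboloid s ∩ cone,
        ∀ (I : List (Fin 4)) (J : List (Fin 3)),
          (I.length + J.length + 2 ≤ N →
            s * p.1 ^ (1 / 2 : ℝ) * |derivWord I J u p| ≤ C * energySum N s u ∧
            (∀ a : Fin 3,
              s * p.1 ^ (3 / 2 : ℝ) * |hypD a (derivWord I J u) p| ≤ C * energySum N s u) ∧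
            s ^ 2 * p.1 ^ (1 / 2 : ℝ) * |hypDs (derivWord I J u) p| ≤ C * energySum N s u ∧
            (∀ a : Fin 3,
              s * p.1 ^ (3 / 2 : ℝ) * |derivWord I J (hypD a u) p| ≤ C * energySum N s u) ∧
            s ^ 2 * p.1 ^ (1 / 2 : ℝ) * |derivWord I J (hypDs u) p| ≤ C * energySum N s u) ∧
          (I.length + J.length + 3 ≤ N →
            (∀ a : Fin 3,
              s ^ 2 * p.1 ^ (3 / 2 : ℝ) * |hypDs (hypD a (derivWord I J u)) p|
                ≤ C * energySum N s u) ∧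
            (∀ a b : Fin 3,
              s * p.1 ^ (5 / 2 : ℝ) * |hypD a (hypD b (derivWord I J u)) p|
                ≤ C * energySum N s u) ∧
            (∀ a : Fin 3,
              s ^ 2 * p.1 ^ (3 / 2 : ℝ) * |derivWord I J (hypDs (hypD a u)) p|
                ≤ C * energySum N s u) ∧
            (∀ a b : Fin 3,
              s * p.1 ^ (5 / 2 : ℝ) * |derivWord I J (hypD a (hypD b u)) p|
                ≤ C * energySum N s u)) := by
  obtain ⟨C, hC, h1⟩ := exists_uniform_const (finite_words 2 N)
    (q := fun IJ C => FirstEstimates N IJ.1 IJ.2 C) (fun _ _ _ hCD h => h.mono hCD)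
    fun _ h => exists_firstEstimates h
  obtain ⟨D, hD, h2⟩ := exists_uniform_const (finite_words 3 N)
    (q := fun IJ C => SecondEstimates N IJ.1 IJ.2 C) (fun _ _ _ hCD h => h.mono hCD)
    fun _ h => exists_secondEstimates h
  refine ⟨C + D + 1, by positivity, fun u hu hv s hs p hp I J => ?_⟩
  obtain ⟨v, hvs, huv⟩ := exists_coneSupported_eqOn hu hv
  have hd := derivWord_congr huv I J
  have hb : ∀ {μ : ℝ → ℝ → ℝ} {P : Operator} {B : ℝ}, DecayBound N μ P B → B ≤ C + D + 1 →
      Set.EqOn (P u) (P v) cone → μ s p.1 * |P u p| ≤ (C + D + 1) * energySum N s u :=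
    fun h hB hP => by
      rw [hP hp.2, energySum_congr N s huv]
      exact h.mono hB v hvs s hs p hp
  refine ⟨fun h => ?_, fun h => ?_⟩
  · obtain ⟨b1, b2, b3, b4, b5⟩ := h1 (I, J) h
    exact ⟨hb b1 (by linarith) hd, fun a => hb (b2 a) (by linarith) (hypD_congr hd a),
      hb b3 (by linarith) (hypDs_congr hd),
      fun a => hb (b4 a) (by linarith) (derivWord_congr (hypD_congr huv a) I J),
      hb b5 (by linarith) (derivWord_congr (hypDs_congr huv) I J)⟩
  · obtain ⟨b1, b2, b3, b4⟩ := h2 (I, J) h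
    exact ⟨fun a => hb (b1 a) (by linarith) (hypDs_congr (hypD_congr hd a)),
      fun a b => hb (b2 (a, b)) (by linarith) (hypD_congr (hypD_congr hd b) a),
      fun a => hb (b3 a) (by linarith) (derivWord_congr (hypDs_congr (hypD_congr huv a)) I J),
      fun a b => hb (b4 (a, b)) (by linarith)
        (derivWord_congr (hypD_congr (hypD_congr huv b) a) I J)⟩
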